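/- Let $d\ge 2$, let $|\cdot|$ be the Euclidean norm on $\mathbb Z^d$ and $B_R=\{x\in\mathbb Z^d:|x|\le R\}$. Let $(\Omega,\mathscr F,\mathbb P)$ be a probability space carrying a stationary and ergodic group of measurable shifts $\{\tau_x:x\in\mathbb Z^d\}$ ($\tau_0=\mathrm{id}$, $\tau_{x+y}=\tau_x\circ\tau_y$), and let $\{C_{x,y}\}_{x,y\in\mathbb Z^d}$ be non-negative random variables with $C_{x,y}(\omega)=C_{y,x}(\omega)$, $C_{x+z,y+z}(\omega)=C_{x,y}(\tau_z\omega)$, such that almost surely $\sum_{y}C_{x,y}(\omega)\in(0,\infty)$ for all $x$. Put $\mathcal L^\omega f(x)=\sum_{y}(f(y)-f(x))C_{x,y}(\omega)$ and $$\tilde\mu_m(\omega)=\sum_{z\in\mathbb Z^d}|z|^mC_{0,z}(\omega),\qquad \tilde\nu(\omega)=\sum_{|z|=1}\frac1{C_{0,z}(\omega)},\qquad \mu_m(x,\omega)=\tilde\mu_m(\tau_x\omega),\quad \mu=\mu_2,\quad \nu(x,\omega)=\tilde\nu(\tau_x\omega),$$ with $1/0=\infty$. For a finite $A\subset\mathbb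 Z^d$ let $\|f\|_{r,A}=\big(|A|^{-1}\sum_{x\in A}|f(x)|^r\big)^{1/r}$ for $r<\infty$ and $\|f\|_{\infty,A}=\max_A|f|$, and for a bounded interval $I$ let $\|f\|_{r,2,I\times A}=\big(|I|^{-1}\int_I\|f(t,\cdot)\|_{r,A}^2\,dt\big)^{1/2}$. Let $Q_{s,R}=[-s,0]\times B_R$. **Theorem (maximal inequality for caloric functions).** Assume that $\tilde\mu_2\in L^p(\Omega;\mathbb P)$ and $\tilde\nu\in L^q(\Omega;\mathbb P)$ for some $p,q\in(1,\infty]$ with $$\Big(1-\frac1d\Big)\frac1p+\frac1q\le\frac1d,$$ and that $\tilde\mu_m\in L^p(\Omega;\mathbb P)$ for some real $m\ge2$. Let $p_*=p/(p-1)$ ($p_*=1$ if $p=\infty$). Then there exist deterministic constants $C,\kappa>0$ and a random variable $N_0=N_0(\omega)>0$ such that for almost every $\omega$ the following holds. For every integer $n>N_0(\omega)$, every bounded $u:(-4n^2,0]\times\mathbb Z^d\to\mathbb R$ with $$\partial_tu(t,x)=\mathcal L^\omega u(t,\cdot)(x),\qquad (t,x)\in(-4n^2,0]\times B_{2n}$$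 (one-sided derivative at $t=0$), every $\delta\in(0,2)$ and all $\frac12\le\theta'<\theta<1$, $$\max_{(t,x)\in Q_{\theta'n^2,\theta'n}}|u(t,x)|\le\delta\,n^{-(m-2)}\sup_{(s,x)\in(-n^2,0]\times\mathbb Z^d}|u(s,x)|+C\Big(\frac{M_n}{\delta(\theta-\theta')^{m+3}}\Big)^{\kappa}\|u\|_{2p_*,2,Q_{\theta n^2,\theta n}},$$ where $$M_n=\|\max\{\mu(\cdot,\omega),1\}\|_{p,B_{\theta n}}\cdot\|\max\{\mu_m(\cdot,\omega),1\}\|_{p,B_{\theta n}}\cdot\|\max\{\nu(\cdot,\omega),1\}\|_{q,B_{\theta n}}.$$ The constants $C,\kappa$ do not depend on $\omega$, $n$, $u$, $\delta$, $\theta$, $\theta'$. -/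

import Mathlib

open MeasureTheory Set
open scoped ENNReal NNReal

/-- The integer lattice `ℤ^d`. -/
abbrev ZGrid (d : ℕ) : Type := Fin d → ℤ

/-- The Euclidean norm `|z|` on `ℤ^d`. -/
noncomputable def eucl {d : ℕ} (z : ZGrid d) : ℝ := Real.sqrt (∑ i, (z i : ℝ) ^ 2)

theorem abs_coord_le_eucl {d : ℕ} (z : ZGrid d) (i : Fin d) : |(z i : ℝ)| ≤ eucl z := by
  unfold eucl
  rw [← Real.sqrt_sq_eq_abs]
  exact Real.sqrt_le_sqrt
    (Finset.single_le_sum (f := fun i => (z i : ℝ) ^ 2) (fun j _ => sq_nonneg _)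
      (Finset.mem_univ i))

open Classical in
/-- The closed Euclidean lattice ball `B_R = {z ∈ ℤ^d : |z| ≤ R}` centred at the origin. -/
noncomputable def latBall (d : ℕ) (R : ℝ) : Finset (ZGrid d) :=
  (Finset.Icc (fun _ => -⌊R⌋) (fun _ => ⌊R⌋)).filter (fun z => eucl z ≤ R)

theorem mem_latBall {d : ℕ} {R : ℝ} {z : ZGrid d} : z ∈ latBall d R ↔ eucl z ≤ R := by
  classical
  unfold latBall
  simp only [Finset.mem_filter, Finset.mem_Icc, and_iff_right_iff_imp]
  intro h
  have key : ∀ i, |z i| ≤ ⌊R⌋ := fun i => by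
    rw [Int.le_floor]
    push_cast
    exact (abs_coord_le_eucl z i).trans h
  exact ⟨fun i => (abs_le.mp (key i)).1, fun i => (abs_le.mp (key i)).2⟩

/-- A stationary and ergodic group of shifts `τ` on `(Ω, P)` together with a family of symmetric,
shift-covariant random conductances whose total weights `π_x` lie in `(0, ∞)` almost surely. -/
structure RandomConductance (d : ℕ) (Ω : Type*) [MeasurableSpace Ω] (P : Measure Ω) where
  /-- the shifts -/
  τ : ZGrid d → Ω → Ω
  τ_zero : τ 0 = id
  τ_add : ∀ x y, τ (x + y) = τ x ∘ τ y
  measurable_τ : ∀ x, Measurable (τ x)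
  stationary : ∀ (x : ZGrid d) (A : Set Ω), MeasurableSet A → P (τ x '' A) = P A
  ergodic : ∀ A : Set Ω, MeasurableSet A → (∀ x, τ x '' A = A) → P A = 0 ∨ P A = 1
  /-- the conductances `C_{x,y}(ω)` -/
  C : ZGrid d → ZGrid d → Ω → ℝ≥0
  measurable_C : ∀ x y, Measurable (C x y)
  symm : ∀ x y ω, C x y ω = C y x ω
  covariant : ∀ x y z ω, C (x + z) (y + z) ω = C x y (τ z ω)
  total_weight : ∀ᵐ ω ∂P, ∀ x,
    0 < ∑' y, (C x y ω : ℝ≥0∞) ∧ ∑' y, (C x y ω : ℝ≥0∞) < ∞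

namespace RandomConductance

variable {d : ℕ} {Ω : Type*} [MeasurableSpace Ω] {P : Measure Ω}

/-- `μ̃_m(ω) = ∑_z |z|^m C_{0,z}(ω)`, with values in `[0, ∞]`. -/
noncomputable def moment (E : RandomConductance d Ω P) (m : ℝ) (ω : Ω) : ℝ≥0∞ :=
  ∑' z : ZGrid d, ENNReal.ofReal (eucl z ^ m) * (E.C 0 z ω : ℝ≥0∞)

/-- `ν̃(ω) = ∑_{|z| = 1} 1 / C_{0,z}(ω)`, with values in `[0, ∞]` (here `1 / 0 = ∞`). -/
noncomputable def invMoment (E : RandomConductance d Ω P) (ω : Ω) : ℝ≥0∞ :=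
  ∑' z : {z : ZGrid d // eucl z = 1}, (E.C 0 z.1 ω : ℝ≥0∞)⁻¹

/-- `μ_m(x, ω) = μ̃_m(τ_x ω)` as a real number. -/
noncomputable def mu (E : RandomConductance d Ω P) (m : ℝ) (ω : Ω) (x : ZGrid d) : ℝ :=
  (E.moment m (E.τ x ω)).toReal

/-- `ν(x, ω) = ν̃(τ_x ω)` as a real number. -/
noncomputable def nu (E : RandomConductance d Ω P) (ω : Ω) (x : ZGrid d) : ℝ :=
  (E.invMoment (E.τ x ω)).toReal

/-- The generator `𝓛^ω f(x) = ∑_y (f(y) - f(x)) C_{x,y}(ω)`. -/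
noncomputable def generator (E : RandomConductance d Ω P) (ω : Ω) (f : ZGrid d → ℝ)
    (x : ZGrid d) : ℝ :=
  ∑' y : ZGrid d, (f y - f x) * (E.C x y ω : ℝ)

/-- `u` solves `∂_t u = 𝓛^ω u` on `(-T, 0] × B_R`; the time derivative is the classical one,
and it is one-sided at `t = 0`. -/
def IsCaloric (E : RandomConductance d Ω P) (ω : Ω) (T R : ℝ) (u : ℝ → ZGrid d → ℝ) : Prop :=
  ∀ t ∈ Ioc (-T) 0, ∀ x ∈ latBall d R,
    HasDerivWithinAt (fun s => u s x) (E.generator ω (u t) x) (Ioc (-T) 0) t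

end RandomConductance

/-- The normalised norm `‖f‖_{p,A} = (|A|⁻¹ ∑_{x ∈ A} |f x|^p)^{1/p}`, a maximum for `p = ∞`. -/
noncomputable def avgNorm {d : ℕ} (p : ℝ≥0∞) (A : Finset (ZGrid d)) (f : ZGrid d → ℝ) : ℝ :=
  if p = ∞ then ⨆ x : A, |f x|
  else ((A.card : ℝ)⁻¹ * ∑ x ∈ A, |f x| ^ p.toReal) ^ (1 / p.toReal)

/-- The normalised space-time norm
`‖f‖_{p,r,I×A} = (|I|⁻¹ ∫_I ‖f(t,·)‖_{p,A}^r dt)^{1/r}`, an essential supremum in time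
for `r = ∞`. -/
noncomputable def parNorm {d : ℕ} (p r : ℝ≥0∞) (I : Set ℝ) (A : Finset (ZGrid d))
    (f : ℝ → ZGrid d → ℝ) : ℝ :=
  if r = ∞ then essSup (fun t => avgNorm p A (f t)) (volume.restrict I)
  else ((volume.real I)⁻¹ * ∫ t in I, avgNorm p A (f t) ^ r.toReal) ^ (1 / r.toReal)

/-- `sup {|u(s,x)| : (s,x) ∈ (-T, 0] × ℤ^d}`. -/
noncomputable def globalSup {d : ℕ} (T : ℝ) (u : ℝ → ZGrid d → ℝ) : ℝ :=
  ⨆ z : Ioc (-T) (0 : ℝ) × ZGrid d, |u z.1 z.2|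

/-- `‖max{μ,1}‖_{p,B_R} ‖max{μ_m,1}‖_{p,B_R} ‖max{ν,1}‖_{q,B_R}`, where `μ = μ_2`. -/
noncomputable def RandomConductance.momentFactor {d : ℕ} {Ω : Type*} [MeasurableSpace Ω]
    {P : Measure Ω} (E : RandomConductance d Ω P) (p q : ℝ≥0∞) (m : ℝ) (ω : Ω) (R : ℝ) : ℝ :=
  avgNorm p (latBall d R) (fun x => max (E.mu 2 ω x) 1) *
    avgNorm p (latBall d R) (fun x => max (E.mu m ω x) 1) *
    avgNorm q (latBall d R) (fun x => max (E.nu ω x) 1)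

/-! ### A discrete Gagliardo–Nirenberg–Sobolev inequality -/

/-! The proof is a De Giorgi iteration over truncations `(u - l)_+`, for `u` and then for `-u`. The
estimate itself is deterministic: probability only supplies a full-measure set on which all the
moments are finite at every site, and the averages of these moments enter the bound explicitly
through `M_n`.

Two inequalities play against each other. The energy estimate (`energy_estimate`) tests the equation
with `η² (u - l)_+` for a spatial cutoff `η`. The commutator with the cutoff costs `μ_2`. Long
jumps, from the support of `η` out of the ball, have length at least `h`; there `u` is only known to
be bounded by `S`, and Markov's inequality turns their rate into `h^{-m} μ_m`. This tail is linear
in the truncation, not quadratic. It is absorbed by lowering the level by `Δ`, since `(u - l - Δ)_+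
≤ Δ⁻¹ (u - l)_+²`, and by choosing the final level `k` at least `δ n^{-(m-2)} S`. This is where the
first term of the theorem comes from.

The weighted Sobolev inequality (`rpow_sum_le_nnEnergy`) bounds the `L^{2p_*}` norm by the nearest
neighbour energy and the `L^q` norm of `ν`, with a gain: a factor `(size of the support)^ε`, where
`ε = 2/d - 1/p - 1/q`. The hypothesis on `p, q` together with `p > 1` makes `ε` positive. By
Chebyshev's inequality the support of the next truncation is controlled by the sup-in-time `L²`
bound of the energy estimate.

Combining them (`levelMass_step`), the mass `y_i` of the truncation at level `k - k 2^{-i}` on the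
cylinder of size `θ' + (θ - θ') 2^{-i}`, divided by `k²`, satisfies `y_{i+1} ≤ (K β^i y_i)^{1+ε}`.
Such a sequence tends to `0` once `y_0` is small enough (`tendsto_zero_of_superlinear`), which holds
if `k` dominates a suitable power of `M_n / (δ (θ - θ')^{m+1})` times the norm of `u`. Then `(u -
k)_+` vanishes on the inner cylinder. -/

theorem abs_le_sum_range_abs_sub (g : ℤ → ℝ) (a : ℤ) (n : ℕ) :
    |g a| ≤ |g (a - n)| + ∑ j ∈ Finset.range n, |g (a - j) - g (a - j - 1)| := by
  induction n with
  | zero => simp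
  | succ n ih =>
    rw [Finset.sum_range_succ]
    have h : |g (a - n)| ≤ |g (a - n) - g (a - n - 1)| + |g (a - n - 1)| := by
      have := abs_add_le (g (a - n) - g (a - n - 1)) (g (a - n - 1))
      simpa using this
    have e : a - ((n + 1 : ℕ) : ℤ) = a - n - 1 := by push_cast; ring
    rw [e]
    linarith

theorem enorm_le_tsum_enorm_sub (g : ℤ → ℝ) (hg : g.support.Finite) (a : ℤ) :
    ‖g a‖ₑ ≤ ∑' k : ℤ, ‖g (k + 1) - g k‖ₑ := by
  obtain ⟨n, hn⟩ : ∃ n : ℕ, g (a - n) = 0 := by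
    by_contra! h
    refine Set.infinite_of_injective_forall_mem (f := fun n : ℕ => a - n) ?_ h hg
    intro x y hxy
    simpa using hxy
  have h1 : ‖g a‖ₑ ≤ ∑ j ∈ Finset.range n, ‖g (a - j) - g (a - j - 1)‖ₑ := by
    have := abs_le_sum_range_abs_sub g a n
    rw [hn, abs_zero, zero_add] at this
    simp only [← ofReal_norm, Real.norm_eq_abs]
    rw [← ENNReal.ofReal_sum_of_nonneg (fun _ _ => abs_nonneg _)]
    exact ENNReal.ofReal_le_ofReal this
  refine h1.trans ?_
  have hinj : Function.Injective (fun j : ℕ => a - j - 1) := by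
    intro x y hxy
    simpa using hxy
  calc ∑ j ∈ Finset.range n, ‖g (a - j) - g (a - j - 1)‖ₑ
      ≤ ∑' j : ℕ, ‖g (a - j - 1 + 1) - g (a - j - 1)‖ₑ := by
        simpa using ENNReal.sum_le_tsum (f := fun j : ℕ => ‖g (a - j) - g (a - j - 1)‖ₑ)
          (Finset.range n)
    _ ≤ _ := ENNReal.tsum_comp_le_tsum_of_injective hinj (fun k => ‖g (k + 1) - g k‖ₑ)

theorem lintegral_pi_count_int {d : ℕ} (f : ZGrid d → ℝ≥0∞) :
    ∫⁻ x, f x ∂(Measure.pi fun _ => (Measure.count : Measure ℤ)) = ∑' x, f x := by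
  rw [lintegral_countable']
  simp

/-- Gagliardo's argument: along each coordinate line through `x`, telescoping bounds `F x` by the
total variation on that line. The product of the `d` bounds, each to the power `1/(d-1)`, is summed
by the grid-lines inequality for the counting measure. -/
theorem tsum_rpow_le_tsum_grad_rpow {d : ℕ} (hd : 2 ≤ d) (F : ZGrid d → ℝ)
    (hF : F.support.Finite) :
    ∑' x, ‖F x‖ₑ ^ ((d : ℝ) / (d - 1)) ≤
      (∑' x, ∑ i, ‖F (x + Pi.single i 1) - F x‖ₑ) ^ ((d : ℝ) / (d - 1)) := by
  have hd1 : (1 : ℝ) < d := by exact_mod_cast hd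
  have hconj : Real.HolderConjugate (Fintype.card (Fin d) : ℝ) ((d : ℝ) / (d - 1)) := by
    rw [Fintype.card_fin]
    exact Real.HolderConjugate.conjExponent hd1
  have key := lintegral_prod_lintegral_pow_le (A := fun _ : Fin d => ℤ)
    (fun _ => (Measure.count : Measure ℤ)) hconj
    (f := fun x => ∑ i, ‖F (x + Pi.single i 1) - F x‖ₑ) (measurable_of_countable _)
  rw [lintegral_pi_count_int, lintegral_pi_count_int] at key
  refine le_trans (ENNReal.tsum_le_tsum fun x => ?_) key
  have hline : ∀ i : Fin d, ‖F x‖ₑ ≤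
      ∫⁻ k, ∑ l, ‖F (Function.update x i k + Pi.single l 1) - F (Function.update x i k)‖ₑ
        ∂(Measure.count : Measure ℤ) := by
    intro i
    rw [lintegral_count]
    have h1 := enorm_le_tsum_enorm_sub (fun k => F (Function.update x i k))
      (hF.preimage (Function.update_injective x i).injOn) (x i)
    rw [Function.update_eq_self] at h1
    refine h1.trans (ENNReal.tsum_le_tsum fun k => ?_)
    have e : Function.update x i (k + 1) = Function.update x i k + Pi.single i 1 := by
      ext j
      by_cases hj : j = i
      · subst hj; simp
      · simp [hj]
    rw [e]
    exact Finset.single_le_sum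
      (f := fun l => ‖F (Function.update x i k + Pi.single l 1) - F (Function.update x i k)‖ₑ)
      (fun _ _ => zero_le) (Finset.mem_univ i)
  calc ‖F x‖ₑ ^ ((d : ℝ) / (d - 1)) = ∏ _i : Fin d, ‖F x‖ₑ ^ ((1 : ℝ) / (d - 1)) := by
        rw [Finset.prod_const, Finset.card_univ, Fintype.card_fin, ← ENNReal.rpow_natCast,
          ← ENNReal.rpow_mul]
        congr 1
        field_simp
    _ ≤ _ := by
        refine Finset.prod_le_prod' fun i _ => ?_
        rw [Fintype.card_fin]
        exact ENNReal.rpow_le_rpow (hline i) (by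
          have : (0 : ℝ) < d - 1 := by linarith
          positivity)

/-- The unit vectors `± e_i` of `ℤ^d`. -/
def unitVec {d : ℕ} (j : Fin d × ℤˣ) : ZGrid d := Pi.single j.1 (j.2 : ℤ)

theorem unitVec_neg {d : ℕ} (j : Fin d × ℤˣ) : unitVec (j.1, -j.2) = -unitVec j := by
  simp [unitVec, ← Pi.single_neg]

theorem eucl_unitVec {d : ℕ} (j : Fin d × ℤˣ) : eucl (unitVec j) = 1 := by
  have h : ∀ i, ((unitVec j i : ℤ) : ℝ) ^ 2 = if i = j.1 then 1 else 0 := by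
    intro i
    by_cases hi : i = j.1
    · subst hi
      rcases Int.units_eq_one_or j.2 with h | h <;> simp [unitVec, h]
    · simp [unitVec, hi]
  simp [eucl, h]

/-- For `b ≤ a` this is Bernoulli's inequality for `(b/a)^γ`, that is, convexity of the power at the
larger point; the second summand on the right only makes the bound symmetric. -/
theorem abs_rpow_sub_rpow_le {a b γ : ℝ} (ha : 0 ≤ a) (hb : 0 ≤ b) (hγ : 1 ≤ γ) :
    |a ^ γ - b ^ γ| ≤ γ * |a - b| * (a ^ (γ - 1) + b ^ (γ - 1)) := by
  wlog hab : b ≤ a generalizing a b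
  · have := this hb ha (le_of_not_ge hab)
    rwa [abs_sub_comm, abs_sub_comm b a, add_comm] at this
  rcases ha.eq_or_lt with rfl | ha'
  · have : b = 0 := le_antisymm hab hb
    subst this
    simp
  rw [abs_of_nonneg (sub_nonneg.2 (Real.rpow_le_rpow hb hab (by linarith))),
    abs_of_nonneg (sub_nonneg.2 hab)]
  have h1 := one_add_mul_self_le_rpow_one_add (s := b / a - 1) (by
    have : 0 ≤ b / a := by positivity
    linarith) hγ
  have e1 : (1 + (b / a - 1)) ^ γ = b ^ γ / a ^ γ := by
    rw [← Real.div_rpow hb ha]; congr 1; ring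
  have e2 : a ^ γ = a ^ (γ - 1) * a := by
    rw [← Real.rpow_add_one ha'.ne']; congr 1; ring
  rw [e1, le_div_iff₀ (by positivity)] at h1
  have h2 : (1 + γ * (b / a - 1)) * a ^ γ = a ^ γ - γ * (a - b) * a ^ (γ - 1) := by
    rw [e2]; field_simp; ring
  rw [h2] at h1
  have h3 : 0 ≤ γ * (a - b) * b ^ (γ - 1) := by
    have := sub_nonneg.2 hab
    positivity
  nlinarith

/-- Each undirected edge is seen from both endpoints: shift `x` by `unitVec j` and replace `j` by
its opposite. -/
theorem tsum_grad_symm {d : ℕ} (f g : ZGrid d → ℝ) :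
    ∑' x, ∑ j, ‖f (x + unitVec j) - f x‖ₑ * ‖g (x + unitVec j)‖ₑ =
      ∑' x, ∑ j, ‖f (x + unitVec j) - f x‖ₑ * ‖g x‖ₑ := by
  rw [Summable.tsum_finsetSum (fun _ _ => ENNReal.summable),
    Summable.tsum_finsetSum (fun _ _ => ENNReal.summable)]
  have hinv : Function.Involutive (fun j : Fin d × ℤˣ => (j.1, -j.2)) := fun j => by simp
  let σ : Equiv.Perm (Fin d × ℤˣ) := Function.Involutive.toPerm _ hinv
  rw [← Equiv.sum_comp σ
    (fun j => ∑' x, ‖f (x + unitVec j) - f x‖ₑ * ‖g x‖ₑ)]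
  refine Finset.sum_congr rfl fun j _ => ?_
  have : unitVec (σ j) = -unitVec j := unitVec_neg j
  rw [this]
  refine Eq.trans (tsum_congr fun x => ?_) (Equiv.tsum_eq (Equiv.addRight (unitVec j)) _)
  simp only [Equiv.coe_addRight, add_neg_cancel_right]
  rw [← enorm_neg, neg_sub]

/-- The `L¹` inequality applied to `f ^ γ`, with the discrete chain rule `abs_rpow_sub_rpow_le`. By
symmetry of the edges both endpoint weights can be moved to `x`; since `γ > 1`, the weight `f x ^ (γ
- 1)` vanishes off `A`, so edges are only counted from sites of `A`. -/
theorem sum_rpow_rpow_le_sum_grad {d : ℕ} (hd : 2 ≤ d) (A : Finset (ZGrid d))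
    (f : ZGrid d → ℝ) (hf : ∀ x, 0 ≤ f x) (hfA : ∀ x, x ∉ A → f x = 0) {γ : ℝ} (hγ : 1 < γ) :
    (∑ x ∈ A, f x ^ (γ * ((d : ℝ) / (d - 1)))) ^ (1 - 1 / (d : ℝ)) ≤
      2 * γ * ∑ x ∈ A, ∑ j, |f (x + unitVec j) - f x| * f x ^ (γ - 1) := by
  have hd1 : (1 : ℝ) < d := by exact_mod_cast hd
  have hr : 0 < (d : ℝ) / (d - 1) := div_pos (by linarith) (by linarith)
  have hγ0 : γ ≠ 0 := by linarith
  have hγ1 : γ - 1 ≠ 0 := by linarith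
  have hF : (fun x => f x ^ γ).support.Finite := by
    refine A.finite_toSet.subset fun x hx => ?_
    by_contra h
    exact hx (by simp [hfA x h, Real.zero_rpow hγ0])
  have h1 := tsum_rpow_le_tsum_grad_rpow hd _ hF
  have hS : ∑' x, ∑ i, ‖f (x + Pi.single i 1) ^ γ - f x ^ γ‖ₑ ≤
      ENNReal.ofReal (2 * γ * ∑ x ∈ A, ∑ j, |f (x + unitVec j) - f x| * f x ^ (γ - 1)) := by
    have hpt : ∀ x j, ‖f (x + unitVec j) ^ γ - f x ^ γ‖ₑ ≤ ENNReal.ofReal γ *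
        (‖f (x + unitVec j) - f x‖ₑ * ‖f x ^ (γ - 1)‖ₑ
          + ‖f (x + unitVec j) - f x‖ₑ * ‖f (x + unitVec j) ^ (γ - 1)‖ₑ) := by
      intro x j
      have := abs_rpow_sub_rpow_le (hf (x + unitVec j)) (hf x) hγ.le
      simp only [← ofReal_norm, Real.norm_eq_abs]
      rw [abs_of_nonneg (Real.rpow_nonneg (hf x) _),
        abs_of_nonneg (Real.rpow_nonneg (hf (x + unitVec j)) _),
        ← ENNReal.ofReal_mul (abs_nonneg _), ← ENNReal.ofReal_mul (abs_nonneg _),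
        ← ENNReal.ofReal_add (mul_nonneg (abs_nonneg _) (Real.rpow_nonneg (hf x) _))
          (mul_nonneg (abs_nonneg _) (Real.rpow_nonneg (hf (x + unitVec j)) _)),
        ← ENNReal.ofReal_mul (by linarith)]
      refine ENNReal.ofReal_le_ofReal (this.trans (le_of_eq (by ring)))
    calc ∑' x, ∑ i, ‖f (x + Pi.single i 1) ^ γ - f x ^ γ‖ₑ
        ≤ ∑' x, ∑ j, ‖f (x + unitVec j) ^ γ - f x ^ γ‖ₑ := by
          refine ENNReal.tsum_le_tsum fun x => ?_
          rw [Fintype.sum_prod_type]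
          refine Finset.sum_le_sum fun i _ => ?_
          have e : (Pi.single i 1 : ZGrid d) = unitVec (i, 1) := by simp [unitVec]
          rw [e]
          exact Finset.single_le_sum
            (f := fun σ : ℤˣ => ‖f (x + unitVec (i, σ)) ^ γ - f x ^ γ‖ₑ)
            (fun _ _ => zero_le) (Finset.mem_univ (1 : ℤˣ))
      _ ≤ ∑' x, ∑ j, ENNReal.ofReal γ *
        (‖f (x + unitVec j) - f x‖ₑ * ‖f x ^ (γ - 1)‖ₑ
          + ‖f (x + unitVec j) - f x‖ₑ * ‖f (x + unitVec j) ^ (γ - 1)‖ₑ) :=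
          ENNReal.tsum_le_tsum fun x => Finset.sum_le_sum fun j _ => hpt x j
      _ = ENNReal.ofReal γ * (2 *
          ∑' x, ∑ j, ‖f (x + unitVec j) - f x‖ₑ * ‖f x ^ (γ - 1)‖ₑ) := by
          simp_rw [← Finset.mul_sum, Finset.sum_add_distrib]
          rw [ENNReal.tsum_mul_left, ENNReal.tsum_add,
            tsum_grad_symm f (fun x => f x ^ (γ - 1)), two_mul]
      _ = _ := by
          rw [tsum_eq_sum (s := A) (fun x hx => by
            simp [hfA x hx, Real.zero_rpow hγ1])]
          have : ∀ x j, ‖f (x + unitVec j) - f x‖ₑ * ‖f x ^ (γ - 1)‖ₑ =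
              ENNReal.ofReal (|f (x + unitVec j) - f x| * f x ^ (γ - 1)) := by
            intro x j
            rw [ENNReal.ofReal_mul (abs_nonneg _), ← Real.norm_eq_abs, ofReal_norm,
              ← abs_of_nonneg (Real.rpow_nonneg (hf x) (γ - 1)), ← Real.norm_eq_abs (f x ^ _),
              ofReal_norm, enorm_norm]
          have hnn : ∀ x j, 0 ≤ |f (x + unitVec j) - f x| * f x ^ (γ - 1) := fun x j =>
            mul_nonneg (abs_nonneg _) (Real.rpow_nonneg (hf x) _)
          simp_rw [this]
          rw [Finset.sum_congr rfl
            (fun x _ => (ENNReal.ofReal_sum_of_nonneg (fun j _ => hnn x j)).symm),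
            ← ENNReal.ofReal_sum_of_nonneg
              (fun x _ => Finset.sum_nonneg fun j _ => hnn x j),
            mul_comm 2 γ, mul_assoc, ENNReal.ofReal_mul (by linarith),
            ENNReal.ofReal_mul (by norm_num)]
          simp
  have hR : 0 ≤ 2 * γ * ∑ x ∈ A, ∑ j, |f (x + unitVec j) - f x| * f x ^ (γ - 1) :=
    mul_nonneg (by linarith) (Finset.sum_nonneg fun x _ => Finset.sum_nonneg fun j _ =>
      mul_nonneg (abs_nonneg _) (Real.rpow_nonneg (hf x) _))
  have h2 : ENNReal.ofReal (∑ x ∈ A, f x ^ (γ * ((d : ℝ) / (d - 1)))) ≤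
      ENNReal.ofReal ((2 * γ * ∑ x ∈ A, ∑ j, |f (x + unitVec j) - f x| * f x ^ (γ - 1)) ^
        ((d : ℝ) / (d - 1))) := by
    rw [← ENNReal.ofReal_rpow_of_nonneg hR hr.le]
    refine le_trans ?_ (h1.trans (ENNReal.rpow_le_rpow hS hr.le))
    rw [ENNReal.ofReal_sum_of_nonneg (fun x _ => Real.rpow_nonneg (hf x) _)]
    refine le_trans (le_of_eq ?_) (ENNReal.sum_le_tsum A)
    refine Finset.sum_congr rfl fun x _ => ?_
    rw [Real.rpow_mul (hf x), ← ENNReal.ofReal_rpow_of_nonneg (Real.rpow_nonneg (hf x) _) hr.le,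
      ← ofReal_norm, Real.norm_eq_abs, abs_of_nonneg (Real.rpow_nonneg (hf x) _)]
  rw [ENNReal.ofReal_le_ofReal_iff (Real.rpow_nonneg hR _)] at h2
  calc (∑ x ∈ A, f x ^ (γ * ((d : ℝ) / (d - 1)))) ^ (1 - 1 / (d : ℝ))
      ≤ ((2 * γ * ∑ x ∈ A, ∑ j, |f (x + unitVec j) - f x| * f x ^ (γ - 1)) ^
        ((d : ℝ) / (d - 1))) ^ (1 - 1 / (d : ℝ)) := by
        refine Real.rpow_le_rpow (Finset.sum_nonneg fun x _ => Real.rpow_nonneg (hf x) _) h2 ?_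
        rw [sub_nonneg, div_le_one (by linarith)]
        exact hd1.le
    _ = _ := by
        rw [← Real.rpow_mul hR]
        have : (d : ℝ) / (d - 1) * (1 - 1 / (d : ℝ)) = 1 := by
          have : (d : ℝ) - 1 ≠ 0 := by linarith
          field_simp
        rw [this, Real.rpow_one]

/-! ### Normalised norms -/

/-- `1 - 1/p`, the reciprocal of the exponent conjugate to `p`. -/
noncomputable def coInv (p : ℝ≥0∞) : ℝ := 1 - (1 / p).toReal

theorem coInv_top : coInv ∞ = 1 := by simp [coInv]

theorem one_lt_toReal {p : ℝ≥0∞} (hp : 1 < p) (hpt : p ≠ ∞) : 1 < p.toReal := by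
  have := (ENNReal.toReal_lt_toReal ENNReal.one_ne_top hpt).2 hp
  simpa using this

theorem coInv_eq {p : ℝ≥0∞} : coInv p = 1 - 1 / p.toReal := by
  simp [coInv, ENNReal.toReal_inv]

theorem coInv_pos {p : ℝ≥0∞} (hp : 1 < p) : 0 < coInv p := by
  by_cases hpt : p = ∞
  · simp [hpt, coInv_top]
  · have := one_lt_toReal hp hpt
    rw [coInv_eq, sub_pos, div_lt_one (by linarith)]
    exact this

theorem toReal_conjExponent_eq {p : ℝ≥0∞} (hp : 1 < p) :
    p.conjExponent.toReal = 1 / coInv p := by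
  by_cases hpt : p = ∞
  · subst hpt
    simp [coInv_top, ENNReal.conjExponent]
  · have h1 := one_lt_toReal hp hpt
    have h2 : (p - 1).toReal = p.toReal - 1 := by
      rw [ENNReal.toReal_sub_of_le hp.le hpt, ENNReal.toReal_one]
    have h3 : p - 1 ≠ 0 := by
      rw [Ne, tsub_eq_zero_iff_le]; exact not_le.2 hp
    rw [coInv_eq, ENNReal.conjExponent, ENNReal.toReal_add ENNReal.one_ne_top
      (ENNReal.inv_ne_top.2 h3), ENNReal.toReal_inv, h2, ENNReal.toReal_one]
    have : p.toReal - 1 ≠ 0 := by linarith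
    field_simp
    ring

theorem conjExponent_ne_top {p : ℝ≥0∞} (hp : 1 < p) : p.conjExponent ≠ ∞ := by
  have h3 : p - 1 ≠ 0 := by
    rw [Ne, tsub_eq_zero_iff_le]; exact not_le.2 hp
  rw [ENNReal.conjExponent]
  exact ENNReal.add_ne_top.2 ⟨ENNReal.one_ne_top, ENNReal.inv_ne_top.2 h3⟩

section

variable {d : ℕ}

theorem avgNorm_nonneg (p : ℝ≥0∞) (A : Finset (ZGrid d)) (f : ZGrid d → ℝ) :
    0 ≤ avgNorm p A f := by
  unfold avgNorm
  split_ifs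
  · exact Real.iSup_nonneg fun _ => abs_nonneg _
  · exact Real.rpow_nonneg (mul_nonneg (by positivity)
      (Finset.sum_nonneg fun _ _ => Real.rpow_nonneg (abs_nonneg _) _)) _

theorem one_le_avgNorm {p : ℝ≥0∞} (hp : p ≠ 0) {A : Finset (ZGrid d)} (hA : A.Nonempty)
    {f : ZGrid d → ℝ} (hf : ∀ x ∈ A, 1 ≤ f x) : 1 ≤ avgNorm p A f := by
  unfold avgNorm
  split_ifs with h
  · obtain ⟨x, hx⟩ := hA
    exact ((hf x hx).trans (le_abs_self _)).trans
      (le_ciSup (f := fun x : A => |f x|) (Set.finite_range _).bddAbove ⟨x, hx⟩)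
  · have hp0 := ENNReal.toReal_pos hp h
    have hc : (0 : ℝ) < A.card := by exact_mod_cast hA.card_pos
    refine Real.one_le_rpow ?_ (by positivity)
    rw [← div_eq_inv_mul, one_le_div hc]
    calc (A.card : ℝ) = ∑ x ∈ A, 1 := by simp
      _ ≤ _ := Finset.sum_le_sum fun x hx =>
        Real.one_le_rpow ((hf x hx).trans (le_abs_self _)) hp0.le

/-- Hölder's inequality. Writing the conjugate exponent as `1 / coInv p` keeps one formula for
finite and infinite `p`. -/
theorem sum_mul_le_avgNorm_mul {p : ℝ≥0∞} (hp : 1 < p) (A : Finset (ZGrid d))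
    {g φ : ZGrid d → ℝ} (hg : ∀ x, 0 ≤ g x) (hφ : ∀ x, 0 ≤ φ x) :
    ∑ x ∈ A, g x * φ x ≤ A.card * avgNorm p A g *
      ((A.card : ℝ)⁻¹ * ∑ x ∈ A, φ x ^ (1 / coInv p)) ^ coInv p := by
  rcases A.eq_empty_or_nonempty with rfl | hA
  · simp
  have hc : (0 : ℝ) < A.card := by exact_mod_cast hA.card_pos
  by_cases hpt : p = ∞
  · subst hpt
    simp only [coInv_top, div_one, Real.rpow_one, avgNorm, if_true]
    have : ∑ x ∈ A, g x * φ x ≤ ∑ x ∈ A, (⨆ x : A, |g x|) * φ x := by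
      refine Finset.sum_le_sum fun x hx => mul_le_mul_of_nonneg_right ?_ (hφ x)
      exact (le_abs_self _).trans
        (le_ciSup (f := fun x : A => |g x|) (Set.finite_range _).bddAbove ⟨x, hx⟩)
    refine this.trans (le_of_eq ?_)
    rw [← Finset.mul_sum]
    field_simp
  · have h1 := one_lt_toReal hp hpt
    have hP : p.toReal ≠ 0 := by linarith
    have hP1 : p.toReal - 1 ≠ 0 := by linarith
    have hb := coInv_pos hp
    have hconj : p.toReal.HolderConjugate (1 / coInv p) := by
      have : 1 / coInv p = p.toReal.conjExponent := by
        rw [coInv_eq, Real.conjExponent]; field_simp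
      rw [this]
      exact Real.HolderConjugate.conjExponent h1
    have h2 := Real.inner_le_Lp_mul_Lq_of_nonneg A hconj (fun x _ => hg x) (fun x _ => hφ x)
    refine h2.trans (le_of_eq ?_)
    rw [one_div_one_div, avgNorm, if_neg hpt]
    simp only [abs_of_nonneg (hg _)]
    rw [Real.mul_rpow (by positivity) (Finset.sum_nonneg fun x _ => Real.rpow_nonneg (hg x) _),
      Real.mul_rpow (by positivity) (Finset.sum_nonneg fun x _ => Real.rpow_nonneg (hφ x) _)]
    have e : (A.card : ℝ) * (((A.card : ℝ)⁻¹) ^ (1 / p.toReal) * ((A.card : ℝ)⁻¹) ^ coInv p)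
        = 1 := by
      rw [← Real.rpow_add (by positivity), coInv_eq]
      have : 1 / p.toReal + (1 - 1 / p.toReal) = 1 := by ring
      rw [this, Real.rpow_one, mul_inv_cancel₀ hc.ne']
    calc _ = ((A.card : ℝ) * (((A.card : ℝ)⁻¹) ^ (1 / p.toReal) * ((A.card : ℝ)⁻¹) ^ coInv p)) *
          ((∑ x ∈ A, g x ^ p.toReal) ^ (1 / p.toReal) *
            (∑ x ∈ A, φ x ^ (1 / coInv p)) ^ coInv p) := by rw [e, one_mul]
      _ = _ := by ring

theorem avgNorm_two_mul_conjExponent_sq {p : ℝ≥0∞} (hp : 1 < p) (A : Finset (ZGrid d))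
    (f : ZGrid d → ℝ) :
    avgNorm (2 * p.conjExponent) A f ^ (2 : ℝ) =
      ((A.card : ℝ)⁻¹ * ∑ x ∈ A, |f x| ^ (2 / coInv p)) ^ coInv p := by
  have hb := coInv_pos hp
  have h : 2 * p.conjExponent ≠ ∞ := ENNReal.mul_ne_top (by simp) (conjExponent_ne_top hp)
  rw [avgNorm, if_neg h, ENNReal.toReal_mul, toReal_conjExponent_eq hp, ← Real.rpow_mul
    (mul_nonneg (by positivity) (Finset.sum_nonneg fun x _ => Real.rpow_nonneg (abs_nonneg _) _))]
  congr 1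
  · simp [div_eq_mul_inv]
  · simp

/-! ### The weighted Sobolev inequality -/

/-- The nearest neighbour part of the Dirichlet energy, over edges with an endpoint in `A`. -/
noncomputable def nnEnergy (c : ZGrid d → ZGrid d → ℝ) (A : Finset (ZGrid d))
    (f : ZGrid d → ℝ) : ℝ :=
  ∑ x ∈ A, ∑ j, c x (x + unitVec j) * (f (x + unitVec j) - f x) ^ 2

/-- Hölder's inequality against the indicator of the support of `f`. This is the source of the power
of the support size that drives the iteration. -/
theorem sum_rpow_le_card_rpow_mul (A : Finset (ZGrid d)) {f : ZGrid d → ℝ} (hf : ∀ x, 0 ≤ f x)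
    {a l s : ℝ} (ha : 0 < a) (hal : a < l) (hs : ((A.filter fun x => f x ≠ 0).card : ℝ) ≤ s) :
    ∑ x ∈ A, f x ^ a ≤ (∑ x ∈ A, f x ^ l) ^ (a / l) * s ^ (1 - a / l) := by
  have hl : 0 < l := ha.trans hal
  have hP : 1 < l / a := (one_lt_div ha).2 hal
  have hconj := Real.HolderConjugate.conjExponent hP
  have h1 := Real.inner_le_Lp_mul_Lq_of_nonneg (A.filter fun x => f x ≠ 0) hconj
    (f := fun x => f x ^ a) (g := fun _ => 1) (fun x _ => Real.rpow_nonneg (hf x) _)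
    (fun _ _ => zero_le_one)
  have e1 : ∀ x, (f x ^ a) ^ (l / a) = f x ^ l := fun x => by
    rw [← Real.rpow_mul (hf x)]; congr 1; field_simp
  have e2 : ∀ t : ℝ, 0 < t → ∑ x ∈ A.filter (fun x => f x ≠ 0), f x ^ t = ∑ x ∈ A, f x ^ t := by
    intro t ht
    refine Finset.sum_filter_of_ne fun x _ hx h0 => hx ?_
    rw [h0, Real.zero_rpow ht.ne']
  have e3 : 1 / (l / a).conjExponent = 1 - a / l := by
    rw [Real.conjExponent]
    have : l - a ≠ 0 := by linarith
    field_simp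
  have e4 : 1 / (l / a) = a / l := by field_simp
  simp only [mul_one, e1, Real.one_rpow, Finset.sum_const, nsmul_eq_mul] at h1
  rw [e2 a ha, e2 l hl, e3, e4] at h1
  refine h1.trans (mul_le_mul_of_nonneg_left (Real.rpow_le_rpow (by positivity) hs ?_)
    (Real.rpow_nonneg (Finset.sum_nonneg fun x _ => Real.rpow_nonneg (hf x) _) _))
  rw [sub_nonneg, div_le_one hl]
  exact hal.le

/-- Cauchy–Schwarz splits the right side of the Sobolev inequality into the energy and a sum of `c⁻¹
f^{2(γ-1)}`, which Hölder's inequality bounds through the `L^q` norm of `ν`. The excess of the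
Sobolev exponent over `2 / coInv p` is converted into the factor `s ^ ε`. -/
theorem rpow_sum_le_nnEnergy (hd : 2 ≤ d) {p q : ℝ≥0∞} (hp : 1 < p) (hq : 1 < q)
    {c : ZGrid d → ZGrid d → ℝ} {ν : ZGrid d → ℝ} {A D : Finset (ZGrid d)} (hDA : D ⊆ A)
    (hc : ∀ x j, 0 < c x (x + unitVec j)) (hν : ∀ x j, (c x (x + unitVec j))⁻¹ ≤ ν x)
    {f : ZGrid d → ℝ} (hf : ∀ x, 0 ≤ f x) (hfA : ∀ x, x ∉ D → f x = 0) {s ε : ℝ}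
    (hs : ((D.filter fun x => f x ≠ 0).card : ℝ) ≤ s)
    (hε : ε = coInv p + coInv q - 2 + 2 / d) (hε0 : 0 < ε) :
    (∑ x ∈ D, f x ^ (2 / coInv p)) ^ coInv p ≤
      8 * d * (1 + coInv q / coInv p) ^ 2 * s ^ ε * nnEnergy c D f *
        ((A.card : ℝ) ^ (1 - coInv q) * avgNorm q A ν) := by
  have hd1 : (1 : ℝ) < d := by exact_mod_cast hd
  have hb := coInv_pos hp
  have hb' := coInv_pos hq
  set b := coInv p
  set b' := coInv q
  -- The choice of `γ` makes `2 (γ - 1) / b' = a`, so Hölder's inequality with `ν` reproduces the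
  -- same sum `Z` that is being estimated.
  set γ := 1 + b' / b with hγ
  set a := 2 / b with ha
  set r := (d : ℝ) / (d - 1) with hr
  have hγ1 : 1 < γ := by have : 0 < b' / b := by positivity
                         linarith
  have hr1 : 1 - 1 / (d : ℝ) = 1 / r := by rw [hr]; field_simp
  have hr0 : 0 < r := div_pos (by linarith) (by linarith)
  have ha0 : 0 < a := by positivity
  have hs0 : 0 ≤ s := le_trans (by positivity) hs
  have e1 : γ / a - 1 / r = ε / 2 := by
    rw [← hr1, hε, ha, hγ]; field_simp; ring
  have hal : a < γ * r := by
    have h1 : 1 / r < γ / a := by linarith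
    rw [div_lt_div_iff₀ hr0 ha0] at h1
    linarith
  set Z := ∑ x ∈ D, f x ^ a with hZ
  have hZ0 : 0 ≤ Z := Finset.sum_nonneg fun x _ => Real.rpow_nonneg (hf x) _
  set W := ∑ x ∈ D, f x ^ (γ * r) with hW
  have hW0 : 0 ≤ W := Finset.sum_nonneg fun x _ => Real.rpow_nonneg (hf x) _
  have hν0 : ∀ x, 0 ≤ ν x := fun x =>
    le_trans (inv_nonneg.2 (hc x (⟨0, by omega⟩, 1)).le) (hν x (⟨0, by omega⟩, 1))
  have hE0 : 0 ≤ nnEnergy c D f :=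
    Finset.sum_nonneg fun x _ => Finset.sum_nonneg fun j _ => mul_nonneg (hc x j).le (sq_nonneg _)
  have hnu := avgNorm_nonneg q A ν
  set V := (A.card : ℝ) ^ (1 - b') * avgNorm q A ν with hV
  have hV0 : 0 ≤ V := by positivity
  have hsob : W ^ (1 / r) ≤ 2 * γ * ∑ x ∈ D, ∑ j, |f (x + unitVec j) - f x| * f x ^ (γ - 1) := by
    have := sum_rpow_rpow_le_sum_grad hd D f hf hfA hγ1
    rwa [hr1] at this
  have hcs : (∑ x ∈ D, ∑ j, |f (x + unitVec j) - f x| * f x ^ (γ - 1)) ^ 2 ≤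
      nnEnergy c D f * (2 * d * (V * Z ^ b')) := by
    have h1 : (∑ x ∈ D, ∑ j, |f (x + unitVec j) - f x| * f x ^ (γ - 1)) ^ 2 ≤
        nnEnergy c D f *
          ∑ x ∈ D, ∑ j : Fin d × ℤˣ, (c x (x + unitVec j))⁻¹ * f x ^ (2 * (γ - 1)) := by
      unfold nnEnergy
      rw [← Finset.sum_product', ← Finset.sum_product', ← Finset.sum_product']
      refine Finset.sum_sq_le_sum_mul_sum_of_sq_le_mul _
        (fun i _ => mul_nonneg (hc _ _).le (sq_nonneg _))
        (fun i _ => mul_nonneg (inv_nonneg.2 (hc _ _).le) (Real.rpow_nonneg (hf _) _))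
        fun i _ => le_of_eq ?_
      have := (hc i.1 i.2).ne'
      rw [mul_pow, sq_abs, mul_comm 2 (γ - 1), Real.rpow_mul (hf _), Real.rpow_two]
      field_simp
    refine h1.trans (mul_le_mul_of_nonneg_left ?_ hE0)
    have h2 : ∑ x ∈ D, ∑ j : Fin d × ℤˣ, (c x (x + unitVec j))⁻¹ * f x ^ (2 * (γ - 1)) ≤
        2 * d * ∑ x ∈ D, ν x * f x ^ (2 * (γ - 1)) := by
      rw [Finset.mul_sum]
      refine Finset.sum_le_sum fun x _ => ?_
      calc ∑ j : Fin d × ℤˣ, (c x (x + unitVec j))⁻¹ * f x ^ (2 * (γ - 1))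
          ≤ ∑ j : Fin d × ℤˣ, ν x * f x ^ (2 * (γ - 1)) :=
            Finset.sum_le_sum fun j _ =>
              mul_le_mul_of_nonneg_right (hν x j) (Real.rpow_nonneg (hf x) _)
        _ = _ := by
            rw [Finset.sum_const, Finset.card_univ, Fintype.card_prod, Fintype.card_fin,
              Fintype.card_units_int, nsmul_eq_mul]
            push_cast
            ring
    refine h2.trans (mul_le_mul_of_nonneg_left ?_ (by positivity))
    have h3 := sum_mul_le_avgNorm_mul hq A hν0 (φ := fun x => f x ^ (2 * (γ - 1)))
      (fun x => Real.rpow_nonneg (hf x) _)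
    refine (Finset.sum_le_sum_of_subset_of_nonneg hDA fun x _ _ =>
      mul_nonneg (hν0 x) (Real.rpow_nonneg (hf x) _)).trans (h3.trans (le_of_eq ?_))
    have e2 : ∀ x, (f x ^ (2 * (γ - 1))) ^ (1 / coInv q) = f x ^ a := fun x => by
      rw [← Real.rpow_mul (hf x)]
      congr 1
      change 2 * (γ - 1) * (1 / b') = a
      rw [hγ, ha]; field_simp; ring
    have e3 : ∑ x ∈ A, f x ^ a = Z :=
      (Finset.sum_subset hDA fun x _ hx => by rw [hfA x hx, Real.zero_rpow ha0.ne']).symm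
    simp only [e2, e3]
    change A.card * avgNorm q A ν * ((A.card : ℝ)⁻¹ * Z) ^ b' = V * Z ^ b'
    rcases A.eq_empty_or_nonempty with rfl | hA
    · simp [hZ, hb'.ne', Finset.subset_empty.1 hDA]
    have hcard : (0 : ℝ) < A.card := by exact_mod_cast hA.card_pos
    rw [Real.mul_rpow (by positivity) hZ0, hV, Real.inv_rpow hcard.le, Real.rpow_sub hcard,
      Real.rpow_one]
    ring
  have hZW : Z ^ (γ / a) ≤ W ^ (1 / r) * s ^ (ε / 2) := by
    have h1 := sum_rpow_le_card_rpow_mul D hf ha0 hal hs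
    calc Z ^ (γ / a) ≤ (W ^ (a / (γ * r)) * s ^ (1 - a / (γ * r))) ^ (γ / a) :=
          Real.rpow_le_rpow hZ0 h1 (by positivity)
      _ = W ^ (1 / r) * s ^ (ε / 2) := by
          rw [Real.mul_rpow (Real.rpow_nonneg hW0 _) (Real.rpow_nonneg hs0 _),
            ← Real.rpow_mul hW0, ← Real.rpow_mul hs0, ← e1]
          have e3 : a / (γ * r) * (γ / a) = 1 / r := by field_simp
          have e4 : (1 - a / (γ * r)) * (γ / a) = γ / a - 1 / r := by field_simp
          rw [e3, e4]
  have hR0 : 0 ≤ 8 * d * γ ^ 2 * s ^ ε * nnEnergy c D f * V := by positivity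
  -- The estimate below reads `Z ^ (b + b') ≤ ... * Z ^ b'`, and `Z ^ b'` can be cancelled only if
  -- `Z` is positive.
  rcases hZ0.eq_or_lt with hZ00 | hZpos
  · rw [← hZ00, Real.zero_rpow hb.ne']
    exact hR0
  have hsq : (Z ^ (γ / a)) ^ 2 ≤ 8 * d * γ ^ 2 * s ^ ε * nnEnergy c D f * V * Z ^ b' := by
    have hT0 : 0 ≤ ∑ x ∈ D, ∑ j, |f (x + unitVec j) - f x| * f x ^ (γ - 1) :=
      Finset.sum_nonneg fun x _ => Finset.sum_nonneg fun j _ =>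
        mul_nonneg (abs_nonneg _) (Real.rpow_nonneg (hf x) _)
    have hss : (s ^ (ε / 2)) ^ 2 = s ^ ε := by
      rw [← Real.rpow_two, ← Real.rpow_mul hs0]; congr 1; ring
    calc (Z ^ (γ / a)) ^ 2 ≤ (W ^ (1 / r) * s ^ (ε / 2)) ^ 2 :=
          pow_le_pow_left₀ (Real.rpow_nonneg hZ0 _) hZW 2
      _ = (W ^ (1 / r)) ^ 2 * s ^ ε := by rw [mul_pow, hss]
      _ ≤ (2 * γ * ∑ x ∈ D, ∑ j, |f (x + unitVec j) - f x| * f x ^ (γ - 1)) ^ 2 * s ^ ε := by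
          gcongr
      _ = 4 * γ ^ 2 * (∑ x ∈ D, ∑ j, |f (x + unitVec j) - f x| * f x ^ (γ - 1)) ^ 2 * s ^ ε := by
          ring
      _ ≤ 4 * γ ^ 2 * (nnEnergy c D f * (2 * d * (V * Z ^ b'))) * s ^ ε := by gcongr
      _ = _ := by ring
  have e5 : (Z ^ (γ / a)) ^ 2 = Z ^ b * Z ^ b' := by
    rw [← Real.rpow_two, ← Real.rpow_mul hZ0, ← Real.rpow_add hZpos]
    congr 1
    rw [hγ, ha]; field_simp
  rw [e5] at hsq
  exact le_of_mul_le_mul_right hsq (Real.rpow_pos_of_pos hZpos _)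

end

/-! ### Cutoff functions -/

theorem eucl_eq_norm {d : ℕ} (z : ZGrid d) :
    eucl z = ‖(WithLp.toLp 2 (fun i => (z i : ℝ)) : EuclideanSpace ℝ (Fin d))‖ := by
  rw [EuclideanSpace.norm_eq]
  simp [eucl]

theorem eucl_nonneg {d : ℕ} (z : ZGrid d) : 0 ≤ eucl z := Real.sqrt_nonneg _

theorem abs_eucl_sub_eucl_le {d : ℕ} (x y : ZGrid d) : |eucl x - eucl y| ≤ eucl (y - x) := by
  rw [eucl_eq_norm x, eucl_eq_norm y, eucl_eq_norm (y - x), abs_sub_comm]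
  refine (abs_norm_sub_norm_le _ _).trans (le_of_eq ?_)
  congr 1
  ext i
  simp

/-- A radial cutoff, equal to `1` for `|x| ≤ R - 2h` and to `0` for `|x| ≥ R - h`. -/
noncomputable def cutoff {d : ℕ} (R h : ℝ) (x : ZGrid d) : ℝ :=
  max 0 (min 1 ((R - h - eucl x) / h))

theorem cutoff_nonneg {d : ℕ} (R h : ℝ) (x : ZGrid d) : 0 ≤ cutoff R h x := le_max_left _ _

theorem cutoff_le_one {d : ℕ} (R h : ℝ) (x : ZGrid d) : cutoff R h x ≤ 1 :=
  max_le zero_le_one (min_le_left _ _)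

theorem cutoff_eq_one {d : ℕ} {R h : ℝ} (hh : 0 < h) {x : ZGrid d} (hx : eucl x ≤ R - 2 * h) :
    cutoff R h x = 1 := by
  have : 1 ≤ (R - h - eucl x) / h := by rw [le_div_iff₀ hh]; linarith
  rw [cutoff, min_eq_left this, max_eq_right zero_le_one]

theorem cutoff_eq_zero {d : ℕ} {R h : ℝ} (hh : 0 < h) {x : ZGrid d} (hx : R - h ≤ eucl x) :
    cutoff R h x = 0 := by
  have : (R - h - eucl x) / h ≤ 0 := div_nonpos_of_nonpos_of_nonneg (by linarith) hh.le
  exact max_eq_left ((min_le_right _ _).trans this)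

theorem abs_cutoff_sub_le {d : ℕ} {R h : ℝ} (hh : 0 < h) (x y : ZGrid d) :
    |cutoff R h x - cutoff R h y| ≤ eucl (y - x) / h := by
  unfold cutoff
  refine (abs_max_sub_max_le_max _ _ _ _).trans (max_le ?_ ?_)
  · simpa using div_nonneg (eucl_nonneg _) hh.le
  refine (abs_min_sub_min_le_max _ _ _ _).trans (max_le ?_ ?_)
  · simpa using div_nonneg (eucl_nonneg _) hh.le
  · rw [← sub_div, abs_div, abs_of_pos hh]
    refine div_le_div_of_nonneg_right ?_ hh.le
    have : R - h - eucl x - (R - h - eucl y) = eucl y - eucl x := by ring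
    rw [this, abs_sub_comm]
    exact abs_eucl_sub_eucl_le x y

/-! ### The energy dissipation of truncations -/

theorem unitVec_injective {d : ℕ} : Function.Injective (unitVec : Fin d × ℤˣ → ZGrid d) := by
  intro j k h
  have hj : unitVec j j.1 = (j.2 : ℤ) := by simp [unitVec]
  by_cases hjk : j.1 = k.1
  · refine Prod.ext hjk ?_
    have hk : unitVec k j.1 = (k.2 : ℤ) := by simp [unitVec, hjk]
    rw [h, hk] at hj
    exact (Units.ext hj).symm
  · have hk : unitVec k j.1 = 0 := by simp [unitVec, hjk]
    rw [h, hk] at hj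
    exact absurd hj.symm j.2.ne_zero

section

variable {d : ℕ}

/-- Discrete summation by parts: averaging over the exchange of `x` and `y` completes the square,
leaving minus the energy of `η w` plus a term in the gradient of the cutoff. -/
theorem sum_sum_cutoff_sq_eq (D : Finset (ZGrid d)) {c : ZGrid d → ZGrid d → ℝ}
    (hsym : ∀ x y, c x y = c y x) (η w : ZGrid d → ℝ) :
    2 * ∑ x ∈ D, ∑ y ∈ D, η x ^ 2 * w x * ((w y - w x) * c x y) =
      ∑ x ∈ D, ∑ y ∈ D, c x y * (w x * w y * (η x - η y) ^ 2)
        - ∑ x ∈ D, ∑ y ∈ D, c x y * (η y * w y - η x * w x) ^ 2 := by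
  have hcomm : ∑ x ∈ D, ∑ y ∈ D, η x ^ 2 * w x * ((w y - w x) * c x y) =
      ∑ x ∈ D, ∑ y ∈ D, η y ^ 2 * w y * ((w x - w y) * c y x) := Finset.sum_comm
  rw [two_mul]
  nth_rewrite 2 [hcomm]
  rw [← Finset.sum_add_distrib, ← Finset.sum_sub_distrib]
  refine Finset.sum_congr rfl fun x _ => ?_
  rw [← Finset.sum_add_distrib, ← Finset.sum_sub_distrib]
  refine Finset.sum_congr rfl fun y _ => ?_
  rw [hsym y x]
  ring

theorem sum_sum_cutoff_sub_sq_le (D : Finset (ZGrid d)) {c : ZGrid d → ZGrid d → ℝ}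
    (hc : ∀ x y, 0 ≤ c x y) (hsym : ∀ x y, c x y = c y x) {μ : ZGrid d → ℝ}
    (hμ : ∀ x, HasSum (fun y => eucl (y - x) ^ (2 : ℝ) * c x y) (μ x))
    {h : ℝ} (hh : 0 < h) {η w : ZGrid d → ℝ}
    (hη : ∀ x y, |η x - η y| ≤ eucl (y - x) / h) :
    ∑ x ∈ D, ∑ y ∈ D, c x y * (w x * w y * (η x - η y) ^ 2) ≤
      (h ^ 2)⁻¹ * ∑ x ∈ D, w x ^ 2 * μ x := by
  have hsymm : ∀ x y : ZGrid d, eucl (y - x) = eucl (x - y) := fun x y => by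
    rw [eucl_eq_norm, eucl_eq_norm, ← norm_neg]
    congr 1
    ext i
    simp
  have h1 : ∀ x y, c x y * (w x * w y * (η x - η y) ^ 2) ≤
      (h ^ 2)⁻¹ * (1 / 2 * (w x ^ 2 * (eucl (y - x) ^ 2 * c x y)))
        + (h ^ 2)⁻¹ * (1 / 2 * (w y ^ 2 * (eucl (x - y) ^ 2 * c y x))) := by
    intro x y
    have e1 : (η x - η y) ^ 2 ≤ (h ^ 2)⁻¹ * eucl (y - x) ^ 2 := by
      rw [← sq_abs]
      refine (pow_le_pow_left₀ (abs_nonneg _) (hη x y) 2).trans (le_of_eq ?_)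
      field_simp
    have e2 : w x * w y ≤ 1 / 2 * (w x ^ 2 + w y ^ 2) := by nlinarith [sq_nonneg (w x - w y)]
    calc c x y * (w x * w y * (η x - η y) ^ 2)
        ≤ c x y * (1 / 2 * (w x ^ 2 + w y ^ 2) * ((h ^ 2)⁻¹ * eucl (y - x) ^ 2)) := by
          refine mul_le_mul_of_nonneg_left ?_ (hc x y)
          exact mul_le_mul e2 e1 (sq_nonneg _) (by positivity)
      _ = _ := by rw [hsymm x y, hsym x y]; ring
  calc ∑ x ∈ D, ∑ y ∈ D, c x y * (w x * w y * (η x - η y) ^ 2)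
      ≤ ∑ x ∈ D, ∑ y ∈ D, ((h ^ 2)⁻¹ * (1 / 2 * (w x ^ 2 * (eucl (y - x) ^ 2 * c x y)))
        + (h ^ 2)⁻¹ * (1 / 2 * (w y ^ 2 * (eucl (x - y) ^ 2 * c y x)))) :=
        Finset.sum_le_sum fun x _ => Finset.sum_le_sum fun y _ => h1 x y
    _ = (h ^ 2)⁻¹ * ∑ x ∈ D, w x ^ 2 * ∑ y ∈ D, eucl (y - x) ^ 2 * c x y := by
        simp_rw [Finset.sum_add_distrib, ← Finset.mul_sum]
        rw [Finset.sum_comm (f := fun x y => w y ^ 2 * (eucl (x - y) ^ 2 * c y x))]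
        simp_rw [← Finset.mul_sum]
        ring
    _ ≤ _ := by
        refine mul_le_mul_of_nonneg_left (Finset.sum_le_sum fun x _ =>
          mul_le_mul_of_nonneg_left ?_ (sq_nonneg _)) (by positivity)
        have := sum_le_hasSum D (fun y _ => mul_nonneg (Real.rpow_nonneg (eucl_nonneg _) _)
          (hc x y)) (hμ x)
        simpa using this

/-- Edges leaving `D` have to be kept: along the iteration the width of the cutoff layer shrinks to
zero and drops below the lattice spacing, so `f` may be nonzero right at the boundary of `D`. -/
theorem nnEnergy_le (D : Finset (ZGrid d)) {c : ZGrid d → ZGrid d → ℝ}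
    (hc : ∀ x y, 0 ≤ c x y) {f : ZGrid d → ℝ} (hf : ∀ x, x ∉ D → f x = 0) :
    nnEnergy c D f ≤ ∑ x ∈ D, ∑ y ∈ D, c x y * (f y - f x) ^ 2 +
      ∑ x ∈ D, ∑ y ∈ (Finset.univ.image fun j => x + unitVec j) \ D, c x y * f x ^ 2 := by
  unfold nnEnergy
  rw [← Finset.sum_add_distrib]
  refine Finset.sum_le_sum fun x _ => ?_
  have hinj : Function.Injective (fun j : Fin d × ℤˣ => x + unitVec j) :=
    (add_right_injective x).comp unitVec_injective
  rw [← Finset.sum_image (f := fun y => c x y * (f y - f x) ^ 2)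
    (g := fun j : Fin d × ℤˣ => x + unitVec j) hinj.injOn,
    ← Finset.sum_inter_add_sum_sdiff _ D]
  refine add_le_add (Finset.sum_le_sum_of_subset_of_nonneg Finset.inter_subset_right
    fun y _ _ => mul_nonneg (hc x y) (sq_nonneg _)) (Finset.sum_le_sum fun y hy => ?_)
  rw [hf y (Finset.mem_sdiff.1 hy).2]
  exact le_of_eq (by ring)

/-- Inside `D` the generator is kept as it is. Outside `D` the positive part of a jump is bounded by
`S` times the `m`-th moment, and the negative part is retained on nearest neighbour edges, to supply
the boundary term of `nnEnergy_le`. -/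
theorem cutoff_mul_generator_le (D : Finset (ZGrid d)) {c : ZGrid d → ZGrid d → ℝ}
    (hc : ∀ x y, 0 ≤ c x y) (hcs : ∀ x, Summable (c x)) {m : ℝ} (hm : 0 ≤ m)
    {μ : ZGrid d → ℝ} (hμ : ∀ x, HasSum (fun y => eucl (y - x) ^ m * c x y) (μ x))
    {h S l : ℝ} (hh : 0 < h) {η v w : ZGrid d → ℝ} (hη0 : ∀ x, 0 ≤ η x) (hη1 : ∀ x, η x ≤ 1)
    (hD : ∀ x y, x ∈ D → y ∉ D → η x ≠ 0 → h ≤ eucl (y - x))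
    (hv : ∀ x, |v x| ≤ S) (hl : 0 ≤ l) (hw : ∀ x, w x = max (v x - l) 0) (x : ZGrid d)
    (hx : x ∈ D) :
    η x ^ 2 * w x * ∑' y, (v y - v x) * c x y ≤
      ∑ y ∈ D, η x ^ 2 * w x * ((w y - w x) * c x y) + S * (h ^ m)⁻¹ * (w x * μ x)
        - ∑ y ∈ (Finset.univ.image fun j => x + unitVec j) \ D, c x y * (η x * w x) ^ 2 := by
  classical
  have hw0 : ∀ x, 0 ≤ w x := fun x => by rw [hw]; exact le_max_right _ _
  have hS : 0 ≤ S := (abs_nonneg _).trans (hv 0)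
  have hwS : ∀ x, w x ≤ S := fun x => by
    rw [hw]; exact max_le (by linarith [(abs_le.1 (hv x)).2]) hS
  have hhm : 0 < h ^ m := Real.rpow_pos_of_pos hh m
  have hsv : Summable fun y => (v y - v x) * c x y := by
    refine Summable.of_norm_bounded ((hcs x).mul_left (2 * S)) fun y => ?_
    rw [norm_mul, Real.norm_eq_abs, Real.norm_eq_abs, abs_of_nonneg (hc x y)]
    refine mul_le_mul_of_nonneg_right ?_ (hc x y)
    have := abs_sub (v y) (v x)
    linarith [hv x, hv y]
  set U : Finset (ZGrid d) := (Finset.univ.image fun j => x + unitVec j) \ D with hU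
  have h1 : HasSum (fun y => if y ∈ D then η x ^ 2 * w x * ((w y - w x) * c x y) else 0)
      (∑ y ∈ D, η x ^ 2 * w x * ((w y - w x) * c x y)) := by
    have := hasSum_sum_of_ne_finset_zero (L := SummationFilter.unconditional _)
      (f := fun y => if y ∈ D then η x ^ 2 * w x * ((w y - w x) * c x y) else 0) (s := D)
      (fun y hy => if_neg hy)
    rwa [Finset.sum_congr rfl fun y hy => if_pos hy] at this
  have h2 : HasSum (fun y => if y ∈ U then c x y * (η x * w x) ^ 2 else 0)
      (∑ y ∈ U, c x y * (η x * w x) ^ 2) := by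
    have := hasSum_sum_of_ne_finset_zero (L := SummationFilter.unconditional _)
      (f := fun y => if y ∈ U then c x y * (η x * w x) ^ 2 else 0) (s := U)
      (fun y hy => if_neg hy)
    rwa [Finset.sum_congr rfl fun y hy => if_pos hy] at this
  have h3 : HasSum (fun y => S * (h ^ m)⁻¹ * w x * (eucl (y - x) ^ m * c x y))
      (S * (h ^ m)⁻¹ * (w x * μ x)) := by
    rw [← mul_assoc]
    exact (hμ x).mul_left _
  rw [← tsum_mul_left]
  refine hasSum_le (fun y => ?_) (hsv.mul_left _).hasSum ((h1.add h3).sub h2)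
  have hcy := hc x y
  have hwx := hw0 x
  have hrest : 0 ≤ S * (h ^ m)⁻¹ * w x * (eucl (y - x) ^ m * c x y) := by
    have := Real.rpow_nonneg (eucl_nonneg (y - x)) m
    positivity
  -- Truncation preserves subsolutions: where `w x > 0` one has `v x = w x + l` and `v y ≤ w y + l`,
  -- and where `w x = 0` both sides vanish.
  have htr : η x ^ 2 * w x * ((v y - v x) * c x y) ≤
      η x ^ 2 * w x * ((w y - w x) * c x y) := by
    rcases hwx.eq_or_lt with h0 | hpos
    · rw [← h0]; simp
    · refine mul_le_mul_of_nonneg_left (mul_le_mul_of_nonneg_right ?_ hcy) (by positivity)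
      have e1 : w x = v x - l := by
        rw [hw] at hpos ⊢
        rcases max_cases (v x - l) 0 with h | h
        · exact h.1
        · linarith [h.1]
      have e2 : v y - l ≤ w y := by rw [hw]; exact le_max_left _ _
      linarith
  refine htr.trans ?_
  by_cases hy : y ∈ D
  · have hyU : y ∉ U := fun h => (Finset.mem_sdiff.1 h).2 hy
    rw [if_pos hy, if_neg hyU]
    linarith
  · rw [if_neg hy, zero_add]
    have hUle : (if y ∈ U then c x y * (η x * w x) ^ 2 else 0) ≤ c x y * (η x * w x) ^ 2 := by
      split_ifs
      · exact le_rfl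
      · positivity
    refine le_trans ?_ (sub_le_sub_left hUle _)
    -- Markov's inequality: a jump from the support of `η` out of `D` has length at least `h`.
    have hmain : η x ^ 2 * w x * (w y * c x y) ≤
        S * (h ^ m)⁻¹ * w x * (eucl (y - x) ^ m * c x y) := by
      by_cases hηx : η x = 0
      · rw [hηx]; simpa using hrest
      have hge : h ^ m ≤ eucl (y - x) ^ m := Real.rpow_le_rpow hh.le (hD x y hx hy hηx) hm
      have hone : 1 ≤ (h ^ m)⁻¹ * eucl (y - x) ^ m := by
        rw [← div_eq_inv_mul, one_le_div hhm]; exact hge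
      calc η x ^ 2 * w x * (w y * c x y) ≤ 1 * w x * (S * c x y) := by
            have := hw0 y
            have := hwS y
            have : η x ^ 2 ≤ 1 := pow_le_one₀ (hη0 x) (hη1 x)
            gcongr
        _ = S * w x * c x y * 1 := by ring
        _ ≤ S * w x * c x y * ((h ^ m)⁻¹ * eucl (y - x) ^ m) :=
            mul_le_mul_of_nonneg_left hone (by positivity)
        _ = _ := by ring
    have e : η x ^ 2 * w x * ((w y - w x) * c x y) =
      η x ^ 2 * w x * (w y * c x y) - c x y * (η x * w x) ^ 2 := by ring
    rw [e]
    linarith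

/-- The nonlocal Caccioppoli inequality at a fixed time. The last term is the tail from long jumps,
linear in `w`. -/
theorem sum_cutoff_mul_generator_le (D : Finset (ZGrid d)) {c : ZGrid d → ZGrid d → ℝ}
    (hc : ∀ x y, 0 ≤ c x y) (hsym : ∀ x y, c x y = c y x) (hcs : ∀ x, Summable (c x))
    {m : ℝ} (hm : 0 ≤ m) {μ μm : ZGrid d → ℝ}
    (hμ : ∀ x, HasSum (fun y => eucl (y - x) ^ (2 : ℝ) * c x y) (μ x))
    (hμm : ∀ x, HasSum (fun y => eucl (y - x) ^ m * c x y) (μm x))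
    {h S l : ℝ} (hh : 0 < h) {η v w : ZGrid d → ℝ} (hη0 : ∀ x, 0 ≤ η x) (hη1 : ∀ x, η x ≤ 1)
    (hηD : ∀ x, x ∉ D → η x = 0) (hη : ∀ x y, |η x - η y| ≤ eucl (y - x) / h)
    (hD : ∀ x y, x ∈ D → y ∉ D → η x ≠ 0 → h ≤ eucl (y - x))
    (hv : ∀ x, |v x| ≤ S) (hl : 0 ≤ l) (hw : ∀ x, w x = max (v x - l) 0) :
    2 * ∑ x ∈ D, η x ^ 2 * w x * ∑' y, (v y - v x) * c x y ≤
      -nnEnergy c D (fun x => η x * w x) + (h ^ 2)⁻¹ * ∑ x ∈ D, w x ^ 2 * μ x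
        + 2 * (S * (h ^ m)⁻¹ * ∑ x ∈ D, w x * μm x) := by
  have h1 := Finset.sum_le_sum fun x hx =>
    cutoff_mul_generator_le D hc hcs hm hμm hh hη0 hη1 hD hv hl hw x hx
  rw [Finset.sum_sub_distrib, Finset.sum_add_distrib, ← Finset.mul_sum] at h1
  have h2 := sum_sum_cutoff_sq_eq D hsym η w
  have h3 := sum_sum_cutoff_sub_sq_le D hc hsym hμ hh hη (w := w)
  have h4 := nnEnergy_le D hc (f := fun x => η x * w x) (fun x hx => by simp [hηD x hx])
  have h5 : 0 ≤ ∑ x ∈ D, ∑ y ∈ (Finset.univ.image fun j => x + unitVec j) \ D,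
      c x y * (η x * w x) ^ 2 :=
    Finset.sum_nonneg fun x _ => Finset.sum_nonneg fun y _ => mul_nonneg (hc x y) (sq_nonneg _)
  linarith

end

/-! ### Integrating a differential inequality -/

/-- The squared positive part is differentiable also at the kink, so the energy of a truncation has
a classical time derivative. -/
theorem hasDerivAt_max_zero_sq (y : ℝ) :
    HasDerivAt (fun z : ℝ => max z 0 ^ 2) (2 * max y 0) y := by
  rcases lt_trichotomy y 0 with hy | rfl | hy
  · rw [max_eq_right hy.le, mul_zero]
    refine (hasDerivAt_const y (0 : ℝ)).congr_of_eventuallyEq ?_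
    filter_upwards [Iio_mem_nhds hy] with z hz
    simp [max_eq_right (le_of_lt (mem_Iio.1 hz))]
  · rw [hasDerivAt_iff_tendsto_slope]
    have h : Filter.Tendsto (fun z : ℝ => max z 0) (nhdsWithin 0 {0}ᶜ) (nhds (max 0 0)) :=
      ((continuous_id.max continuous_const).tendsto 0).mono_left nhdsWithin_le_nhds
    simp only [max_self, mul_zero] at h ⊢
    refine h.congr' ?_
    filter_upwards [self_mem_nhdsWithin] with z hz
    have hz0 : z ≠ 0 := hz
    rw [slope_def_field]
    rcases max_cases z 0 with ⟨h1, _⟩ | ⟨h1, _⟩ <;> rw [h1] <;> simp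
    field_simp
  · rw [max_eq_left hy.le]
    have h1 : HasDerivAt (fun z : ℝ => z ^ 2) (2 * y) y := by
      simpa using hasDerivAt_pow 2 y
    refine h1.congr_of_eventuallyEq ?_
    filter_upwards [Ioi_mem_nhds hy] with z hz
    rw [max_eq_left (le_of_lt (mem_Ioi.1 hz))]

/-- The weight `t - t₀` acts as a linear cutoff in time: it vanishes at the initial time and is at
least `t₁ - t₀` on `[t₁, 0]`. Differentiating `(t - t₀) G` produces the extra source `G`. -/
theorem weighted_gronwall {G G' E H : ℝ → ℝ} {t₀ t₁ : ℝ} (h01 : t₀ ≤ t₁) (ht₁ : t₁ ≤ 0)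
    (hG : ∀ t ∈ Icc t₀ 0, HasDerivWithinAt G (G' t) (Icc t₀ 0) t)
    (hG' : ∀ t ∈ Icc t₀ 0, G' t ≤ -E t + H t)
    (hE : ContinuousOn E (Icc t₀ 0)) (hH : ContinuousOn H (Icc t₀ 0))
    (hG0 : ∀ t ∈ Icc t₀ 0, 0 ≤ G t) (hE0 : ∀ t ∈ Icc t₀ 0, 0 ≤ E t)
    (hH0 : ∀ t ∈ Icc t₀ 0, 0 ≤ H t) :
    (∀ t ∈ Icc t₁ 0, (t₁ - t₀) * G t ≤ ∫ s in t₀..0, (-t₀ * H s + G s)) ∧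
      (t₁ - t₀) * ∫ s in t₁..0, E s ≤ ∫ s in t₀..0, (-t₀ * H s + G s) := by
  have h00 : t₀ ≤ 0 := h01.trans ht₁
  have hGc : ContinuousOn G (Icc t₀ 0) := fun t ht => (hG t ht).continuousWithinAt
  set k : ℝ → ℝ := fun s => (s - t₀) * E s - ((s - t₀) * H s + G s) with hk
  have hkc : ContinuousOn k (Icc t₀ 0) := by
    have : ContinuousOn (fun s : ℝ => s - t₀) (Icc t₀ 0) := by fun_prop
    exact (this.mul hE).sub ((this.mul hH).add hGc)
  -- A continuous extension to the line, so that the primitive is differentiable also at the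
  -- endpoints.
  set K : ℝ → ℝ := IccExtend h00 ((Icc t₀ 0).domRestrict k) with hK
  have hKc : Continuous K := (continuousOn_iff_continuous_domRestrict.1 hkc).Icc_extend'
  have hKk : ∀ s ∈ Icc t₀ 0, K s = k s := fun s hs => by
    rw [hK, IccExtend_of_mem h00 _ hs]; rfl
  have hPd : ∀ t, HasDerivAt (fun t => ∫ s in t₀..t, K s) (K t) t := fun t =>
    intervalIntegral.integral_hasDerivAt_right (hKc.intervalIntegrable _ _)
      (hKc.stronglyMeasurableAtFilter _ _) hKc.continuousAt
  set F : ℝ → ℝ := fun t => (t - t₀) * G t + ∫ s in t₀..t, K s with hF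
  have hFd : ∀ t ∈ Icc t₀ 0,
      HasDerivWithinAt F (1 * G t + (t - t₀) * G' t + K t) (Icc t₀ 0) t := fun t ht =>
    (((hasDerivWithinAt_id t _).sub_const t₀).mul (hG t ht)).add (hPd t).hasDerivWithinAt
  have hanti : AntitoneOn F (Icc t₀ 0) := by
    refine antitoneOn_of_hasDerivWithinAt_nonpos (convex_Icc _ _)
      (fun t ht => (hFd t ht).continuousWithinAt)
      (fun t ht => (hFd t (interior_subset ht)).mono interior_subset) fun t ht => ?_
    have ht' := interior_subset ht
    rw [hKk t ht', hk]
    have h1 := mul_le_mul_of_nonneg_left (hG' t ht') (sub_nonneg.2 ht'.1)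
    simp only
    linarith
  have hint : ∀ {f : ℝ → ℝ} {a b : ℝ}, ContinuousOn f (Icc t₀ 0) → t₀ ≤ a → a ≤ b → b ≤ 0 →
      IntervalIntegrable f volume a b := fun hf ha hab hb =>
    (hf.mono (by rw [uIcc_of_le hab]; exact Icc_subset_Icc ha hb)).intervalIntegrable
  have hlin : ContinuousOn (fun s : ℝ => s - t₀) (Icc t₀ 0) := by fun_prop
  have cE : ContinuousOn (fun s => (s - t₀) * E s) (Icc t₀ 0) := hlin.mul hE
  have cE' : ContinuousOn (fun s => (t₁ - t₀) * E s) (Icc t₀ 0) := continuousOn_const.mul hE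
  have cH : ContinuousOn (fun s => (s - t₀) * H s + G s) (Icc t₀ 0) := (hlin.mul hH).add hGc
  have cH' : ContinuousOn (fun s => -t₀ * H s + G s) (Icc t₀ 0) :=
    (continuousOn_const.mul hH).add hGc
  have hmain : ∀ t ∈ Icc t₀ 0, (t - t₀) * G t + ∫ s in t₀..t, (s - t₀) * E s ≤
      ∫ s in t₀..0, (-t₀ * H s + G s) := by
    intro t ht
    have h1 := hanti ⟨le_rfl, h00⟩ ht ht.1
    simp only [hF, sub_self, zero_mul, intervalIntegral.integral_same, add_zero] at h1
    have h2 : ∫ s in t₀..t, K s =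
        (∫ s in t₀..t, (s - t₀) * E s) - ∫ s in t₀..t, ((s - t₀) * H s + G s) := by
      rw [← intervalIntegral.integral_sub (hint cE le_rfl ht.1 ht.2)
        (hint cH le_rfl ht.1 ht.2)]
      refine intervalIntegral.integral_congr fun s hs => ?_
      rw [uIcc_of_le ht.1] at hs
      exact hKk s ⟨hs.1, hs.2.trans ht.2⟩
    have h3 : ∫ s in t₀..t, ((s - t₀) * H s + G s) ≤ ∫ s in t₀..t, (-t₀ * H s + G s) := by
      refine intervalIntegral.integral_mono_on ht.1
        (hint cH le_rfl ht.1 ht.2)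
        (hint cH' le_rfl ht.1 ht.2) fun s hs => ?_
      have hs' : s ∈ Icc t₀ 0 := ⟨hs.1, hs.2.trans ht.2⟩
      have := mul_le_mul_of_nonneg_right (show s - t₀ ≤ -t₀ by linarith [hs'.2]) (hH0 s hs')
      linarith
    have h4 : ∫ s in t₀..t, (-t₀ * H s + G s) ≤ ∫ s in t₀..0, (-t₀ * H s + G s) := by
      rw [← intervalIntegral.integral_add_adjacent_intervals
        (hint cH' le_rfl ht.1 ht.2)
        (hint cH' ht.1 ht.2 le_rfl)]
      have : 0 ≤ ∫ s in t..0, (-t₀ * H s + G s) :=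
        intervalIntegral.integral_nonneg ht.2 fun s hs => by
          have hs' : s ∈ Icc t₀ 0 := ⟨ht.1.trans hs.1, hs.2⟩
          have := mul_nonneg (neg_nonneg.2 h00) (hH0 s hs')
          linarith [hG0 s hs']
      linarith
    linarith
  refine ⟨fun t ht => ?_, ?_⟩
  · have ht' : t ∈ Icc t₀ 0 := ⟨h01.trans ht.1, ht.2⟩
    have h1 := hmain t ht'
    have h2 : 0 ≤ ∫ s in t₀..t, (s - t₀) * E s :=
      intervalIntegral.integral_nonneg ht'.1 fun s hs =>
        mul_nonneg (sub_nonneg.2 hs.1) (hE0 s ⟨hs.1, hs.2.trans ht'.2⟩)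
    have h3 := mul_le_mul_of_nonneg_right (show t₁ - t₀ ≤ t - t₀ by linarith [ht.1]) (hG0 t ht')
    linarith
  · have h1 := hmain 0 ⟨h00, le_rfl⟩
    have h2 : 0 ≤ (0 - t₀) * G 0 := mul_nonneg (by linarith) (hG0 0 ⟨h00, le_rfl⟩)
    have h3 : ∫ s in t₁..0, (t₁ - t₀) * E s ≤ ∫ s in t₀..0, (s - t₀) * E s := by
      rw [← intervalIntegral.integral_add_adjacent_intervals
        (hint cE le_rfl h01 ht₁) (hint cE h01 ht₁ le_rfl)]
      have h4 : 0 ≤ ∫ s in t₀..t₁, (s - t₀) * E s :=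
        intervalIntegral.integral_nonneg h01 fun s hs =>
          mul_nonneg (sub_nonneg.2 hs.1) (hE0 s ⟨hs.1, hs.2.trans ht₁⟩)
      have h5 : ∫ s in t₁..0, (t₁ - t₀) * E s ≤ ∫ s in t₁..0, (s - t₀) * E s := by
        refine intervalIntegral.integral_mono_on ht₁
          (hint cE' h01 ht₁ le_rfl)
          (hint cE h01 ht₁ le_rfl) fun s hs => ?_
        exact mul_le_mul_of_nonneg_right (by linarith [hs.1]) (hE0 s ⟨h01.trans hs.1, hs.2⟩)
      linarith
    rw [intervalIntegral.integral_const_mul] at h3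
    linarith

/-! ### The energy estimate -/

/-- A bounded solution `u` of the heat equation of the conductances `c` on `(-n², 0] × B_n`,
bounded by `S` everywhere, where `μ` and `μm` are the moments of order `2` and `m` of the
conductances, and `ν` dominates the reciprocals of the nearest neighbour conductances. -/
structure CaloricData {d : ℕ} (c : ZGrid d → ZGrid d → ℝ) (μ μm ν : ZGrid d → ℝ) (m n S : ℝ)
    (u : ℝ → ZGrid d → ℝ) : Prop where
  nonneg : ∀ x y, 0 ≤ c x y
  symm : ∀ x y, c x y = c y x
  summable : ∀ x, Summable (c x)
  hasSum_two : ∀ x, HasSum (fun y => eucl (y - x) ^ (2 : ℝ) * c x y) (μ x)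
  hasSum_moment : ∀ x, HasSum (fun y => eucl (y - x) ^ m * c x y) (μm x)
  unitVec_pos : ∀ x j, 0 < c x (x + unitVec j)
  inv_le : ∀ x j, (c x (x + unitVec j))⁻¹ ≤ ν x
  bound : ∀ t ∈ Ioc (-n ^ 2) 0, ∀ x, |u t x| ≤ S
  deriv : ∀ t ∈ Ioc (-n ^ 2) 0, ∀ x ∈ latBall d n,
    HasDerivWithinAt (fun s => u s x) (∑' y, (u t y - u t x) * c x y) (Ioc (-n ^ 2) 0) t

section

variable {d : ℕ}

/-- `(|A|⁻¹ ∑_{x ∈ A} f(x)^{2p_*})^{1/p_*}`, the square of a normalised norm. -/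
noncomputable def powMean (p : ℝ≥0∞) (A : Finset (ZGrid d)) (f : ZGrid d → ℝ) : ℝ :=
  ((A.card : ℝ)⁻¹ * ∑ x ∈ A, f x ^ (2 / coInv p)) ^ coInv p

open Classical in
/-- The truncation `(u - l)_+` restricted to `D`. -/
noncomputable def trunc (D : Finset (ZGrid d)) (l : ℝ) (u : ZGrid d → ℝ) (x : ZGrid d) : ℝ :=
  if x ∈ D then max (u x - l) 0 else 0

theorem trunc_nonneg (D : Finset (ZGrid d)) (l : ℝ) (u : ZGrid d → ℝ) (x : ZGrid d) :
    0 ≤ trunc D l u x := by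
  unfold trunc
  split_ifs
  · exact le_max_right _ _
  · exact le_rfl

theorem powMean_nonneg (p : ℝ≥0∞) (A : Finset (ZGrid d)) {f : ZGrid d → ℝ} (hf : ∀ x, 0 ≤ f x) :
    0 ≤ powMean p A f :=
  Real.rpow_nonneg (mul_nonneg (by positivity)
    (Finset.sum_nonneg fun x _ => Real.rpow_nonneg (hf x) _)) _

theorem powMean_mono {p : ℝ≥0∞} (hp : 1 < p) (A : Finset (ZGrid d)) {f g : ZGrid d → ℝ}
    (hf : ∀ x, 0 ≤ f x) (hfg : ∀ x, f x ≤ g x) : powMean p A f ≤ powMean p A g := by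
  have hb := coInv_pos hp
  refine Real.rpow_le_rpow (mul_nonneg (by positivity)
    (Finset.sum_nonneg fun x _ => Real.rpow_nonneg (hf x) _)) ?_ hb.le
  exact mul_le_mul_of_nonneg_left (Finset.sum_le_sum fun x _ =>
    Real.rpow_le_rpow (hf x) (hfg x) (by positivity)) (by positivity)

theorem sum_sq_mul_le_powMean {p : ℝ≥0∞} (hp : 1 < p) {A D : Finset (ZGrid d)} (hDA : D ⊆ A)
    (g : ZGrid d → ℝ) (l : ℝ) (v : ZGrid d → ℝ) :
    ∑ x ∈ D, max (v x - l) 0 ^ 2 * g x ≤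
      A.card * avgNorm p A (fun x => max (g x) 1) * powMean p A (trunc D l v) := by
  classical
  have hb := coInv_pos hp
  have h1 := sum_mul_le_avgNorm_mul hp A (g := fun x => max (g x) 1)
    (φ := fun x => trunc D l v x ^ 2) (fun x => le_trans zero_le_one (le_max_right _ _))
    (fun x => sq_nonneg _)
  have e : ∀ x, (trunc D l v x ^ 2) ^ (1 / coInv p) = trunc D l v x ^ (2 / coInv p) := fun x => by
    rw [← Real.rpow_two, ← Real.rpow_mul (trunc_nonneg _ _ _ _)]
    congr 1
    ring
  simp only [e] at h1
  refine le_trans ?_ h1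
  calc ∑ x ∈ D, max (v x - l) 0 ^ 2 * g x ≤ ∑ x ∈ D, max (g x) 1 * trunc D l v x ^ 2 := by
        refine Finset.sum_le_sum fun x hx => ?_
        rw [trunc, if_pos hx, mul_comm]
        exact mul_le_mul_of_nonneg_right (le_max_left _ _) (sq_nonneg _)
    _ ≤ _ := Finset.sum_le_sum_of_subset_of_nonneg hDA fun x _ _ =>
        mul_nonneg (le_trans zero_le_one (le_max_right _ _)) (sq_nonneg _)

/-- The scale invariant `L²`-norm of `(u - l)_+` over the cylinder `[-r n², 0] × B_{rn}`. -/
noncomputable def levelMass (p : ℝ≥0∞) (A : Finset (ZGrid d)) (n : ℝ) (u : ℝ → ZGrid d → ℝ)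
    (r l : ℝ) : ℝ :=
  (n ^ 2)⁻¹ * ∫ t in (-(r * n ^ 2))..0, powMean p A (trunc (latBall d (r * n)) l (u t))

/-- The constant of the energy estimate for cylinders at distance `g` and levels at distance
`Δ`. -/
noncomputable def energyConst (m k δ M g Δ : ℝ) : ℝ :=
  6 * (2 / g) ^ m * g⁻¹ * (k / (δ * Δ)) * M

theorem latBall_mono {r s : ℝ} (h : r ≤ s) : latBall d r ⊆ latBall d s := fun _ hx =>
  mem_latBall.2 ((mem_latBall.1 hx).trans h)

namespace CaloricData

variable {c : ZGrid d → ZGrid d → ℝ} {μ μm ν : ZGrid d → ℝ} {m n S : ℝ}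
  {u : ℝ → ZGrid d → ℝ}

theorem continuousOn (h : CaloricData c μ μm ν m n S u) {r : ℝ} (hn : 0 < n) (hr : r < 1)
    {x : ZGrid d} (hx : x ∈ latBall d n) :
    ContinuousOn (fun t => u t x) (Icc (-(r * n ^ 2)) 0) := by
  have hsub : Icc (-(r * n ^ 2)) 0 ⊆ Ioc (-n ^ 2) 0 := fun t ht =>
    ⟨by nlinarith [ht.1, sq_pos_of_pos hn], ht.2⟩
  exact fun t ht => ((h.deriv t (hsub ht) x hx).mono hsub).continuousWithinAt

theorem continuousOn_max (h : CaloricData c μ μm ν m n S u) {r : ℝ} (hn : 0 < n) (hr : r < 1)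
    {x : ZGrid d} (hx : x ∈ latBall d n) (l : ℝ) :
    ContinuousOn (fun t => max (u t x - l) 0) (Icc (-(r * n ^ 2)) 0) := by
  have : Continuous fun z : ℝ => max (z - l) 0 := by fun_prop
  exact this.comp_continuousOn (h.continuousOn hn hr hx)

theorem continuousOn_powMean (h : CaloricData c μ μm ν m n S u) {p : ℝ≥0∞} (hp : 1 < p)
    (A : Finset (ZGrid d)) (hn : 0 < n) {r r' : ℝ} (hr : r < 1) (hr' : r' ≤ 1) (l : ℝ) :
    ContinuousOn (fun t => powMean p A (trunc (latBall d (r' * n)) l (u t)))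
      (Icc (-(r * n ^ 2)) 0) := by
  have hb := coInv_pos hp
  have h1 : ∀ x, ContinuousOn (fun t => trunc (latBall d (r' * n)) l (u t) x)
      (Icc (-(r * n ^ 2)) 0) := by
    intro x
    unfold trunc
    split_ifs with hx
    · exact h.continuousOn_max hn hr (latBall_mono (by nlinarith) hx) l
    · exact continuousOn_const
  refine ContinuousOn.rpow_const ?_ fun _ _ => Or.inr hb.le
  refine continuousOn_const.mul (continuousOn_finsetSum _ fun x _ => ?_)
  exact (h1 x).rpow_const fun _ _ => Or.inr (by positivity)

theorem hasDerivWithinAt_sum (h : CaloricData c μ μm ν m n S u) {r : ℝ} (hn : 0 < n)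
    (hr : r < 1) (η : ZGrid d → ℝ) (l : ℝ) {t : ℝ} (ht : t ∈ Icc (-(r * n ^ 2)) 0) :
    HasDerivWithinAt (fun t => ∑ x ∈ latBall d (r * n), η x ^ 2 * max (u t x - l) 0 ^ 2)
      (2 * ∑ x ∈ latBall d (r * n), η x ^ 2 * max (u t x - l) 0 *
        ∑' y, (u t y - u t x) * c x y) (Icc (-(r * n ^ 2)) 0) t := by
  have hsub : Icc (-(r * n ^ 2)) 0 ⊆ Ioc (-n ^ 2) 0 := fun t ht =>
    ⟨by nlinarith [ht.1, sq_pos_of_pos hn], ht.2⟩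
  rw [Finset.mul_sum]
  refine HasDerivWithinAt.fun_sum fun x hx => ?_
  have h1 := ((h.deriv t (hsub ht) x (latBall_mono (by nlinarith) hx)).mono hsub).sub_const l
  have h2 := ((hasDerivAt_max_zero_sq (u t x - l)).comp_hasDerivWithinAt t h1).const_mul (η x ^ 2)
  refine h2.congr_deriv ?_
  ring

theorem moment_nonneg (h : CaloricData c μ μm ν m n S u) (x : ZGrid d) : 0 ≤ μ x ∧ 0 ≤ μm x :=
  ⟨(h.hasSum_two x).nonneg fun y => mul_nonneg (Real.rpow_nonneg (eucl_nonneg _) _)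
      (h.nonneg x y),
    (h.hasSum_moment x).nonneg fun y => mul_nonneg (Real.rpow_nonneg (eucl_nonneg _) _)
      (h.nonneg x y)⟩

theorem nnEnergy_nonneg (h : CaloricData c μ μm ν m n S u) (A : Finset (ZGrid d))
    (f : ZGrid d → ℝ) : 0 ≤ nnEnergy c A f :=
  Finset.sum_nonneg fun x _ => Finset.sum_nonneg fun j _ =>
    mul_nonneg (h.unitVec_pos x j).le (sq_nonneg _)

/-- The pointwise-in-time part of the energy estimate. -/
theorem source_le (h : CaloricData c μ μm ν m n S u) {p : ℝ≥0∞} (hp : 1 < p)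
    {A : Finset (ZGrid d)} (hA : A.Nonempty) (hn : 0 < n) (hm : 2 ≤ m) {r s l Δ k δ : ℝ}
    (hs : 0 < s) (hsr : s < r) (hr : r < 1) (hDA : latBall d (r * n) ⊆ A) (hΔ : 0 < Δ)
    (hδ : 0 < δ) (hS : S * n ^ 2 * δ ≤ k * n ^ m) (hS0 : 0 ≤ S) (hk : δ * Δ ≤ 2 * k)
    {η : ZGrid d → ℝ} (hη0 : ∀ x, 0 ≤ η x) (hη1 : ∀ x, η x ≤ 1) (t : ℝ) :
    r * n ^ 2 * ((((r - s) * n / 2) ^ 2)⁻¹ *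
          ∑ x ∈ latBall d (r * n), max (u t x - (l + Δ)) 0 ^ 2 * μ x
        + 2 * (S * (((r - s) * n / 2) ^ m)⁻¹ *
          ∑ x ∈ latBall d (r * n), max (u t x - (l + Δ)) 0 * μm x))
        + ∑ x ∈ latBall d (r * n), η x ^ 2 * max (u t x - (l + Δ)) 0 ^ 2 ≤
      A.card * (r - s) * energyConst m k δ (avgNorm p A (fun x => max (μ x) 1) *
        avgNorm p A (fun x => max (μm x) 1)) (r - s) Δ *
        powMean p A (trunc (latBall d (r * n)) l (u t)) := by
  set D := latBall d (r * n)
  set g := r - s with hg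
  have hg0 : 0 < g := sub_pos.2 hsr
  have hg1 : g ≤ 1 := by linarith
  set N1 := avgNorm p A (fun x => max (μ x) 1) with hN1
  set Nm := avgNorm p A (fun x => max (μm x) 1) with hNm
  set ψ := powMean p A (trunc D l (u t)) with hψ
  have hp0 : p ≠ 0 := (zero_lt_one.trans hp).ne'
  have h1N1 : 1 ≤ N1 := one_le_avgNorm hp0 hA fun x _ => le_max_right _ _
  have h1Nm : 1 ≤ Nm := one_le_avgNorm hp0 hA fun x _ => le_max_right _ _
  have hψ0 : 0 ≤ ψ := powMean_nonneg p A (trunc_nonneg _ _ _)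
  have hle : ∀ x, max (u t x - (l + Δ)) 0 ≤ max (u t x - l) 0 := fun x =>
    max_le_max (by linarith) le_rfl
  have hle0 : ∀ x, 0 ≤ max (u t x - (l + Δ)) 0 := fun x => le_max_right _ _
  -- This makes the linear tail quadratic: wherever the higher truncation is positive, the lower one
  -- exceeds `Δ`.
  have hlin : ∀ x, max (u t x - (l + Δ)) 0 ≤ Δ⁻¹ * max (u t x - l) 0 ^ 2 := by
    intro x
    rw [← div_eq_inv_mul, le_div_iff₀ hΔ]
    rcases le_total (u t x - (l + Δ)) 0 with h0 | h0
    · rw [max_eq_right h0, zero_mul]; positivity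
    · rw [max_eq_left h0, max_eq_left (by linarith)]
      nlinarith
  have hT1 : ∑ x ∈ D, max (u t x - (l + Δ)) 0 ^ 2 * μ x ≤ A.card * N1 * ψ := by
    refine le_trans (Finset.sum_le_sum fun x _ => ?_) (sum_sq_mul_le_powMean hp hDA μ l (u t))
    exact mul_le_mul_of_nonneg_right (pow_le_pow_left₀ (hle0 x) (hle x) 2) (h.moment_nonneg x).1
  have hT2 : ∑ x ∈ D, max (u t x - (l + Δ)) 0 * μm x ≤ Δ⁻¹ * (A.card * Nm * ψ) := by
    refine le_trans (Finset.sum_le_sum fun x _ =>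
      mul_le_mul_of_nonneg_right (hlin x) (h.moment_nonneg x).2) ?_
    simp_rw [mul_assoc Δ⁻¹]
    rw [← Finset.mul_sum]
    exact mul_le_mul_of_nonneg_left (sum_sq_mul_le_powMean hp hDA μm l (u t)) (by positivity)
  have hT3 : ∑ x ∈ D, η x ^ 2 * max (u t x - (l + Δ)) 0 ^ 2 ≤ A.card * N1 * ψ := by
    refine le_trans (Finset.sum_le_sum fun x _ => ?_) (sum_sq_mul_le_powMean hp hDA
      (fun x => max (μ x) 1) l (u t) |>.trans (le_of_eq ?_))
    · calc η x ^ 2 * max (u t x - (l + Δ)) 0 ^ 2 ≤ 1 * max (u t x - l) 0 ^ 2 :=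
          mul_le_mul (pow_le_one₀ (hη0 x) (hη1 x)) (pow_le_pow_left₀ (hle0 x) (hle x) 2)
            (sq_nonneg _) zero_le_one
        _ = max (u t x - l) 0 ^ 2 * 1 := by ring
        _ ≤ _ := mul_le_mul_of_nonneg_left (le_max_right _ _) (sq_nonneg _)
    · simp only [hN1, hψ, max_assoc, max_self]
  have hgm : (2 / g) ^ (2 : ℝ) ≤ (2 / g) ^ m :=
    Real.rpow_le_rpow_of_exponent_le (by rw [le_div_iff₀ hg0]; linarith) hm
  have hgm1 : 1 ≤ (2 / g) ^ m :=
    Real.one_le_rpow (by rw [le_div_iff₀ hg0]; linarith) (by linarith)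
  rw [Real.rpow_two] at hgm
  have hcoef1 : r * n ^ 2 * ((g * n / 2) ^ 2)⁻¹ ≤ (2 / g) ^ m := by
    refine le_trans ?_ hgm
    have : r * n ^ 2 * ((g * n / 2) ^ 2)⁻¹ = r * (2 / g) ^ 2 := by field_simp
    rw [this]
    exact mul_le_of_le_one_left (by positivity) hr.le
  have hcoef2 : r * n ^ 2 * (2 * (S * ((g * n / 2) ^ m)⁻¹)) ≤ 2 * (2 / g) ^ m * (k / δ) := by
    have e1 : (g * n / 2) ^ m = n ^ m * ((2 / g) ^ m)⁻¹ := by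
      rw [← Real.inv_rpow (by positivity), ← Real.mul_rpow hn.le (by positivity)]
      congr 1
      field_simp
    have hnm : 0 < n ^ m := Real.rpow_pos_of_pos hn m
    have e2 : S * n ^ 2 * (n ^ m)⁻¹ ≤ k / δ := by
      rw [le_div_iff₀ hδ, ← div_eq_mul_inv, div_mul_eq_mul_div, div_le_iff₀ hnm]
      exact hS
    rw [e1, mul_inv, inv_inv]
    calc r * n ^ 2 * (2 * (S * ((n ^ m)⁻¹ * (2 / g) ^ m)))
        = r * (2 * (2 / g) ^ m * (S * n ^ 2 * (n ^ m)⁻¹)) := by ring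
      _ ≤ 2 * (2 / g) ^ m * (S * n ^ 2 * (n ^ m)⁻¹) :=
          mul_le_of_le_one_left (by positivity) hr.le
      _ ≤ _ := by gcongr
  -- With this, each of the three source terms is at most `2 a b Q` in the notation below, whence
  -- the `6` in `energyConst`.
  have hkδ : 1 ≤ 2 * (k / (δ * Δ)) := by
    rw [← mul_div_assoc, one_le_div (by positivity)]; exact hk
  have hW1 : 0 ≤ ∑ x ∈ D, max (u t x - (l + Δ)) 0 ^ 2 * μ x :=
    Finset.sum_nonneg fun x _ => mul_nonneg (sq_nonneg _) (h.moment_nonneg x).1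
  have hW2 : 0 ≤ ∑ x ∈ D, max (u t x - (l + Δ)) 0 * μm x :=
    Finset.sum_nonneg fun x _ => mul_nonneg (hle0 x) (h.moment_nonneg x).2
  have hk0 : 0 < k := by nlinarith [mul_pos hδ hΔ]
  have hP1 := mul_le_mul hcoef1 hT1 hW1 (by positivity)
  have hP2 := mul_le_mul hcoef2 hT2 hW2 (by positivity)
  set a := (2 / g) ^ m
  set b := k / (δ * Δ) with hb
  have e3 : 2 * a * (k / δ) * (Δ⁻¹ * (A.card * Nm * ψ)) = 2 * a * b * (A.card * Nm * ψ) := by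
    rw [hb]; field_simp
  rw [e3] at hP2
  have e4 : A.card * g * energyConst m k δ (N1 * Nm) g Δ * ψ =
      6 * a * b * (A.card * (N1 * Nm) * ψ) := by
    change A.card * g * (6 * a * g⁻¹ * b * (N1 * Nm)) * ψ = _
    field_simp
  rw [e4]
  have hNψ : 0 ≤ (A.card : ℝ) * ψ := by positivity
  have hq1 : A.card * N1 * ψ ≤ A.card * (N1 * Nm) * ψ := by
    have := mul_le_mul_of_nonneg_left (le_mul_of_one_le_right (by linarith) h1Nm : N1 ≤ N1 * Nm) hNψ
    linarith
  have hqm : A.card * Nm * ψ ≤ A.card * (N1 * Nm) * ψ := by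
    have := mul_le_mul_of_nonneg_left (le_mul_of_one_le_left (by linarith) h1N1 : Nm ≤ N1 * Nm) hNψ
    linarith
  set Q := A.card * (N1 * Nm) * ψ with hQ
  have hQ0 : 0 ≤ Q := by positivity
  have ha0 : 0 ≤ a := by linarith
  have hab : 1 * a ≤ 2 * b * a := mul_le_mul_of_nonneg_right hkδ ha0
  have haQ : a * Q ≤ 2 * b * a * Q := mul_le_mul_of_nonneg_right (by linarith) hQ0
  have hQa : Q ≤ a * Q := le_mul_of_one_le_left hQ0 hgm1
  have hP1' : a * (A.card * N1 * ψ) ≤ a * Q := mul_le_mul_of_nonneg_left hq1 ha0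
  have hP2' : 2 * a * b * (A.card * Nm * ψ) ≤ 2 * a * b * Q :=
    mul_le_mul_of_nonneg_left hqm (by positivity)
  linarith

/-- The energy estimate: the truncations at level `l + Δ` on the cylinder of size `s` are
controlled by the truncation at level `l` on the cylinder of size `r`. -/
theorem energy_estimate (h : CaloricData c μ μm ν m n S u) {p : ℝ≥0∞} (hp : 1 < p)
    {A : Finset (ZGrid d)} (hA : A.Nonempty) (hn : 0 < n) (hm : 2 ≤ m) {r s l Δ k δ : ℝ}
    (hs : 0 < s) (hsr : s < r) (hr : r < 1) (hDA : latBall d (r * n) ⊆ A) (hl : 0 ≤ l)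
    (hΔ : 0 < Δ) (hδ : 0 < δ) (hS : S * n ^ 2 * δ ≤ k * n ^ m) (hk : δ * Δ ≤ 2 * k) :
    (∀ t ∈ Icc (-(s * n ^ 2)) 0,
      ∑ x ∈ latBall d (s * n), max (u t x - (l + Δ)) 0 ^ 2 ≤
        A.card * energyConst m k δ (avgNorm p A (fun x => max (μ x) 1) *
          avgNorm p A (fun x => max (μm x) 1)) (r - s) Δ * levelMass p A n u r l) ∧
    ContinuousOn (fun t => nnEnergy c (latBall d (r * n)) fun x =>
      cutoff (r * n) ((r - s) * n / 2) x * max (u t x - (l + Δ)) 0) (Icc (-(s * n ^ 2)) 0) ∧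
    (n ^ 2)⁻¹ * ∫ t in (-(s * n ^ 2))..0, nnEnergy c (latBall d (r * n)) (fun x =>
      cutoff (r * n) ((r - s) * n / 2) x * max (u t x - (l + Δ)) 0) ≤
        A.card * energyConst m k δ (avgNorm p A (fun x => max (μ x) 1) *
          avgNorm p A (fun x => max (μm x) 1)) (r - s) Δ * levelMass p A n u r l * (n ^ 2)⁻¹ := by
  set D := latBall d (r * n) with hD
  set hh := (r - s) * n / 2 with hhh
  have hn2 : 0 < n ^ 2 := by positivity
  have hg0 : 0 < r - s := sub_pos.2 hsr
  have hh0 : 0 < hh := by positivity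
  set η : ZGrid d → ℝ := cutoff (r * n) hh with hη
  set K := energyConst m k δ (avgNorm p A (fun x => max (μ x) 1) *
    avgNorm p A (fun x => max (μm x) 1)) (r - s) Δ with hK
  have hsub : Icc (-(r * n ^ 2)) 0 ⊆ Ioc (-n ^ 2) 0 := fun t ht =>
    ⟨by nlinarith [ht.1], ht.2⟩
  have hS0 : 0 ≤ S := (abs_nonneg _).trans (h.bound 0 ⟨by linarith, le_rfl⟩ 0)
  have hηD : ∀ x, x ∉ D → η x = 0 := fun x hx => by
    refine cutoff_eq_zero hh0 ?_
    rw [hD, mem_latBall, not_le] at hx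
    linarith
  -- The cutoff already vanishes at distance `hh` from the edge of `D`, which leaves a layer that
  -- every exiting jump must cross.
  have hηfar : ∀ x y, x ∈ D → y ∉ D → η x ≠ 0 → hh ≤ eucl (y - x) := by
    intro x y _ hy hx
    have h1 : eucl x < r * n - hh := by
      by_contra! hc
      exact hx (cutoff_eq_zero hh0 hc)
    rw [hD, mem_latBall, not_le] at hy
    have h2 := abs_eucl_sub_eucl_le x y
    rw [abs_sub_comm] at h2
    linarith [le_abs_self (eucl y - eucl x)]
  have hηw : ∀ x, ContinuousOn (fun t => η x * max (u t x - (l + Δ)) 0)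
      (Icc (-(r * n ^ 2)) 0) := by
    intro x
    by_cases hx : x ∈ D
    · exact continuousOn_const.mul (h.continuousOn_max hn hr (latBall_mono (by nlinarith) hx) _)
    · simp only [hηD x hx, zero_mul]
      exact continuousOn_const
  have hw : ∀ x ∈ D, ContinuousOn (fun t => max (u t x - (l + Δ)) 0) (Icc (-(r * n ^ 2)) 0) :=
    fun x hx => h.continuousOn_max hn hr (latBall_mono (by nlinarith) hx) _
  have hEc : ContinuousOn (fun t => nnEnergy c D fun x => η x * max (u t x - (l + Δ)) 0)
      (Icc (-(r * n ^ 2)) 0) :=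
    continuousOn_finsetSum _ fun x _ => continuousOn_finsetSum _ fun j _ =>
      continuousOn_const.mul (((hηw _).sub (hηw _)).pow 2)
  have hHc : ContinuousOn (fun t => (hh ^ 2)⁻¹ * ∑ x ∈ D, max (u t x - (l + Δ)) 0 ^ 2 * μ x
      + 2 * (S * (hh ^ m)⁻¹ * ∑ x ∈ D, max (u t x - (l + Δ)) 0 * μm x))
      (Icc (-(r * n ^ 2)) 0) :=
    (continuousOn_const.mul (continuousOn_finsetSum _ fun x hx =>
      ((hw x hx).pow 2).mul continuousOn_const)).add
    (continuousOn_const.mul (continuousOn_const.mul (continuousOn_finsetSum _ fun x hx =>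
      (hw x hx).mul continuousOn_const)))
  have hw0 : ∀ t x, 0 ≤ max (u t x - (l + Δ)) 0 := fun _ _ => le_max_right _ _
  have key := weighted_gronwall (t₀ := -(r * n ^ 2)) (t₁ := -(s * n ^ 2))
    (by nlinarith) (by nlinarith [mul_pos hs hn2])
    (fun t ht => h.hasDerivWithinAt_sum hn hr η (l + Δ) ht)
    (fun t ht => by
      have := sum_cutoff_mul_generator_le D h.nonneg h.symm h.summable
        (by linarith : (0 : ℝ) ≤ m) h.hasSum_two h.hasSum_moment hh0
        (cutoff_nonneg (r * n) hh) (cutoff_le_one (r * n) hh) hηD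
        (abs_cutoff_sub_le hh0) hηfar (h.bound t (hsub ht)) (by linarith : 0 ≤ l + Δ)
        (fun x => rfl)
      rw [add_assoc] at this
      exact this)
    hEc hHc
    (fun t _ => Finset.sum_nonneg fun x _ => mul_nonneg (sq_nonneg _) (sq_nonneg _))
    (fun t _ => h.nnEnergy_nonneg _ _)
    (fun t _ => by
      have h1 : 0 ≤ ∑ x ∈ D, max (u t x - (l + Δ)) 0 ^ 2 * μ x :=
        Finset.sum_nonneg fun x _ => mul_nonneg (sq_nonneg _) (h.moment_nonneg x).1
      have h2 : 0 ≤ ∑ x ∈ D, max (u t x - (l + Δ)) 0 * μm x :=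
        Finset.sum_nonneg fun x _ => mul_nonneg (hw0 t x) (h.moment_nonneg x).2
      have h3 : 0 ≤ hh ^ m := Real.rpow_nonneg hh0.le m
      positivity)
  have hlen : -(s * n ^ 2) - -(r * n ^ 2) = (r - s) * n ^ 2 := by ring
  rw [hlen, neg_neg] at key
  have hGc : ContinuousOn (fun t => ∑ x ∈ D, η x ^ 2 * max (u t x - (l + Δ)) 0 ^ 2)
      (Icc (-(r * n ^ 2)) 0) :=
    fun t ht => (h.hasDerivWithinAt_sum hn hr η (l + Δ) ht).continuousWithinAt
  have hr0 : 0 ≤ r * n ^ 2 := by nlinarith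
  have hint : ∫ t in (-(r * n ^ 2))..0, (r * n ^ 2 *
        ((hh ^ 2)⁻¹ * ∑ x ∈ D, max (u t x - (l + Δ)) 0 ^ 2 * μ x
          + 2 * (S * (hh ^ m)⁻¹ * ∑ x ∈ D, max (u t x - (l + Δ)) 0 * μm x))
        + ∑ x ∈ D, η x ^ 2 * max (u t x - (l + Δ)) 0 ^ 2) ≤
      (r - s) * n ^ 2 * (A.card * K * levelMass p A n u r l) := by
    have hc1 : ContinuousOn (fun t => r * n ^ 2 *
        ((hh ^ 2)⁻¹ * ∑ x ∈ D, max (u t x - (l + Δ)) 0 ^ 2 * μ x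
          + 2 * (S * (hh ^ m)⁻¹ * ∑ x ∈ D, max (u t x - (l + Δ)) 0 * μm x))
        + ∑ x ∈ D, η x ^ 2 * max (u t x - (l + Δ)) 0 ^ 2) (uIcc (-(r * n ^ 2)) 0) := by
      rw [uIcc_of_le (by linarith)]
      exact (continuousOn_const.mul hHc).add hGc
    have hc2 : ContinuousOn (fun t => A.card * (r - s) * K * powMean p A (trunc D l (u t)))
        (uIcc (-(r * n ^ 2)) 0) := by
      rw [uIcc_of_le (by linarith)]
      exact continuousOn_const.mul (h.continuousOn_powMean hp A hn hr hr.le l)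
    refine (intervalIntegral.integral_mono_on (by linarith) hc1.intervalIntegrable
      hc2.intervalIntegrable fun t _ => h.source_le hp hA hn hm hs hsr hr hDA hΔ hδ hS hS0 hk
        (cutoff_nonneg (r * n) hh) (cutoff_le_one (r * n) hh) t).trans (le_of_eq ?_)
    rw [intervalIntegral.integral_const_mul, levelMass, ← hD]
    field_simp
  have hpos : 0 < (r - s) * n ^ 2 := by positivity
  refine ⟨fun t ht => ?_, hEc.mono (Icc_subset_Icc_left (by nlinarith)), ?_⟩
  · have h1 := le_of_mul_le_mul_left ((key.1 t ht).trans hint) hpos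
    refine le_trans ?_ h1
    calc ∑ x ∈ latBall d (s * n), max (u t x - (l + Δ)) 0 ^ 2
        = ∑ x ∈ latBall d (s * n), η x ^ 2 * max (u t x - (l + Δ)) 0 ^ 2 := by
          refine Finset.sum_congr rfl fun x hx => ?_
          rw [hη, cutoff_eq_one hh0 (by rw [mem_latBall] at hx; rw [hhh]; linarith)]
          ring
      _ ≤ _ := Finset.sum_le_sum_of_subset_of_nonneg (latBall_mono (by nlinarith))
          fun x _ _ => mul_nonneg (sq_nonneg _) (sq_nonneg _)
  · have h1 := le_of_mul_le_mul_left (key.2.trans hint) hpos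
    rw [mul_comm]
    exact mul_le_mul_of_nonneg_right h1 (by positivity)

end CaloricData

end

/-! ### The De Giorgi iteration -/

section

variable {d : ℕ}

theorem energyConst_nonneg {m k δ M g Δ : ℝ} (hk : 0 ≤ k) (hδ : 0 ≤ δ) (hM : 0 ≤ M) (hg : 0 ≤ g)
    (hΔ : 0 ≤ Δ) : 0 ≤ energyConst m k δ M g Δ := by
  have : 0 ≤ (2 / g) ^ m := Real.rpow_nonneg (by positivity) m
  unfold energyConst
  positivity

namespace CaloricData

variable {c : ZGrid d → ZGrid d → ℝ} {μ μm ν : ZGrid d → ℝ} {m n S : ℝ}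
  {u : ℝ → ZGrid d → ℝ}

theorem levelMass_nonneg {p : ℝ≥0∞} (A : Finset (ZGrid d)) {r : ℝ} (hr : 0 ≤ r) (l : ℝ) :
    0 ≤ levelMass p A n u r l := by
  refine mul_nonneg (by positivity) (intervalIntegral.integral_nonneg ?_ fun t _ =>
    powMean_nonneg p A (trunc_nonneg _ _ _))
  have := mul_nonneg hr (sq_nonneg n)
  linarith

theorem levelMass_mono (h : CaloricData c μ μm ν m n S u) {p : ℝ≥0∞} (hp : 1 < p)
    (A : Finset (ZGrid d)) (hn : 0 < n) {r s l l' : ℝ} (hs : 0 < s) (hsr : s ≤ r) (hr : r < 1)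
    (hl : l ≤ l') : levelMass p A n u s l' ≤ levelMass p A n u r l := by
  have hn2 : 0 < n ^ 2 := by positivity
  have hc : ∀ {r' : ℝ} (l : ℝ), r' ≤ 1 → ∀ {a b : ℝ}, -(r * n ^ 2) ≤ a → a ≤ b → b ≤ 0 →
      IntervalIntegrable (fun t => powMean p A (trunc (latBall d (r' * n)) l (u t))) volume a b :=
    fun {r'} l hr' {a b} h1 h2 h3 => ContinuousOn.intervalIntegrable
      ((h.continuousOn_powMean hp A hn hr hr' l).mono
        (by rw [uIcc_of_le h2]; exact Icc_subset_Icc h1 h3))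
  have h1 : -(r * n ^ 2) ≤ -(s * n ^ 2) := by nlinarith
  have h2 : -(s * n ^ 2) ≤ 0 := by nlinarith
  refine mul_le_mul_of_nonneg_left ?_ (by positivity)
  rw [← intervalIntegral.integral_add_adjacent_intervals (hc (r' := r) l hr.le le_rfl h1 h2)
    (hc (r' := r) l hr.le h1 h2 le_rfl)]
  have h3 : 0 ≤ ∫ t in (-(r * n ^ 2))..(-(s * n ^ 2)),
      powMean p A (trunc (latBall d (r * n)) l (u t)) :=
    intervalIntegral.integral_nonneg h1 fun t _ => powMean_nonneg p A (trunc_nonneg _ _ _)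
  have h4 : ∫ t in (-(s * n ^ 2))..0, powMean p A (trunc (latBall d (s * n)) l' (u t)) ≤
      ∫ t in (-(s * n ^ 2))..0, powMean p A (trunc (latBall d (r * n)) l (u t)) := by
    refine intervalIntegral.integral_mono_on h2 (hc (r' := s) l' (hsr.trans hr.le) h1 h2 le_rfl)
      (hc (r' := r) l hr.le h1 h2 le_rfl) fun t _ => powMean_mono hp A (trunc_nonneg _ _ _)
        fun x => ?_
    unfold trunc
    split_ifs with hx hx' hx'
    · exact max_le_max (by linarith) le_rfl
    · exact absurd (latBall_mono (by nlinarith) hx) hx'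
    · exact le_max_right _ _
    · exact le_rfl
  linarith

/-- The Sobolev inequality for a truncation, at a fixed time. -/
theorem powMean_trunc_le (h : CaloricData c μ μm ν m n S u) (hd : 2 ≤ d) {p q : ℝ≥0∞}
    (hp : 1 < p) (hq : 1 < q) {A : Finset (ZGrid d)} (hA : A.Nonempty) (hn : 0 < n)
    {r s l Δ ε T : ℝ} (hsr : s < r) (hDA : latBall d (r * n) ⊆ A) (hΔ : 0 < Δ)
    (hε : ε = coInv p + coInv q - 2 + 2 / d) (hε0 : 0 < ε) (t : ℝ)
    (hT : ∑ x ∈ latBall d (r * n), max (u t x - l) 0 ^ 2 ≤ A.card * T) :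
    powMean p A (trunc (latBall d (s * n)) (l + Δ) (u t)) ≤
      8 * d * (1 + coInv q / coInv p) ^ 2 * avgNorm q A ν * (A.card : ℝ) ^ (2 / (d : ℝ) - 1) *
        (T / Δ ^ 2) ^ ε * nnEnergy c (latBall d (r * n)) (fun x =>
          cutoff (r * n) ((r - s) * n / 2) x * max (u t x - (l + Δ)) 0) := by
  classical
  have hcard : (0 : ℝ) < A.card := by exact_mod_cast hA.card_pos
  have hb := coInv_pos hp
  set D := latBall d (r * n) with hD
  have hh0 : 0 < (r - s) * n / 2 := by have := sub_pos.2 hsr; positivity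
  set f : ZGrid d → ℝ := fun x =>
    cutoff (r * n) ((r - s) * n / 2) x * max (u t x - (l + Δ)) 0 with hf
  have hf0 : ∀ x, 0 ≤ f x := fun x => mul_nonneg (cutoff_nonneg _ _ _) (le_max_right _ _)
  have hfD : ∀ x, x ∉ D → f x = 0 := fun x hx => by
    rw [hD, mem_latBall, not_le] at hx
    simp only [hf]
    rw [cutoff_eq_zero hh0 (by linarith), zero_mul]
  have hT0 : 0 ≤ T := by
    have : 0 ≤ ∑ x ∈ D, max (u t x - l) 0 ^ 2 := Finset.sum_nonneg fun x _ => sq_nonneg _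
    exact nonneg_of_mul_nonneg_right (this.trans hT) hcard
  have hsupp : ((D.filter fun x => f x ≠ 0).card : ℝ) ≤ A.card * (T / Δ ^ 2) := by
    rw [← mul_div_assoc, le_div_iff₀ (by positivity)]
    refine le_trans ?_ hT
    calc ((D.filter fun x => f x ≠ 0).card : ℝ) * Δ ^ 2
        = ∑ x ∈ D.filter (fun x => f x ≠ 0), Δ ^ 2 := by simp
      _ ≤ ∑ x ∈ D.filter (fun x => f x ≠ 0), max (u t x - l) 0 ^ 2 := by
          refine Finset.sum_le_sum fun x hx => pow_le_pow_left₀ hΔ.le ?_ 2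
          have h1 : max (u t x - (l + Δ)) 0 ≠ 0 := right_ne_zero_of_mul (Finset.mem_filter.1 hx).2
          have h2 : 0 < u t x - (l + Δ) := by
            by_contra! h0
            exact h1 (max_eq_right h0)
          exact le_max_of_le_left (by linarith)
      _ ≤ _ := Finset.sum_le_sum_of_subset_of_nonneg (Finset.filter_subset _ _)
          fun x _ _ => sq_nonneg _
  have hsob := rpow_sum_le_nnEnergy hd hp hq hDA h.unitVec_pos h.inv_le hf0 hfD hsupp hε hε0
  have h1 : powMean p A (trunc (latBall d (s * n)) (l + Δ) (u t)) ≤ powMean p A f := by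
    refine powMean_mono hp A (trunc_nonneg _ _ _) fun x => ?_
    unfold trunc
    split_ifs with hx
    · rw [mem_latBall] at hx
      simp only [hf]
      rw [cutoff_eq_one hh0 (by linarith), one_mul]
    · exact hf0 x
  refine h1.trans ?_
  have hsum : ∑ x ∈ A, f x ^ (2 / coInv p) = ∑ x ∈ D, f x ^ (2 / coInv p) :=
    (Finset.sum_subset hDA fun x _ hx => by
      rw [hfD x hx, Real.zero_rpow (by positivity)]).symm
  rw [powMean, hsum, Real.mul_rpow (by positivity)
    (Finset.sum_nonneg fun x _ => Real.rpow_nonneg (hf0 x) _)]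
  refine (mul_le_mul_of_nonneg_left hsob (by positivity)).trans (le_of_eq ?_)
  -- By the definition of `ε` all powers of the volume combine to `2/d - 1`, which the energy
  -- estimate turns into `|A|^{2/d} / n²`, a bounded quantity.
  have hcd : (A.card : ℝ)⁻¹ ^ coInv p * ((A.card : ℝ) ^ ε * (A.card : ℝ) ^ (1 - coInv q)) =
      (A.card : ℝ) ^ (2 / (d : ℝ) - 1) := by
    rw [Real.inv_rpow hcard.le, ← Real.rpow_neg hcard.le, ← Real.rpow_add hcard,
      ← Real.rpow_add hcard, hε]
    congr 1
    ring
  rw [Real.mul_rpow hcard.le (by positivity), ← hcd]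
  ring

/-- The energy estimate is used twice. From level `l` to `l + Δ` it gives the sup-in-time `L²`
bound, hence the support size; from `l + Δ` to `l + 2 Δ` it gives the integrated energy. The Sobolev
inequality joins them into a bound of order `1 + ε` in the mass. -/
theorem levelMass_step (h : CaloricData c μ μm ν m n S u) (hd : 2 ≤ d) {p q : ℝ≥0∞}
    (hp : 1 < p) (hq : 1 < q) {A : Finset (ZGrid d)} (hA : A.Nonempty) (hn : 0 < n) (hm : 2 ≤ m)
    (hcard : (A.card : ℝ) ^ (2 / (d : ℝ)) ≤ 9 * n ^ 2) {s g l Δ k δ ε : ℝ}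
    (hs : 0 < s) (hg : 0 < g) (hr : s + 2 * g < 1) (hDA : latBall d ((s + 2 * g) * n) ⊆ A)
    (hl : 0 ≤ l) (hΔ : 0 < Δ) (hδ : 0 < δ) (hS : S * n ^ 2 * δ ≤ k * n ^ m)
    (hk : δ * Δ ≤ 2 * k) (hε : ε = coInv p + coInv q - 2 + 2 / d) (hε0 : 0 < ε) :
    levelMass p A n u s (l + 2 * Δ) ≤ 72 * d * (1 + coInv q / coInv p) ^ 2 * avgNorm q A ν *
      (energyConst m k δ (avgNorm p A (fun x => max (μ x) 1) *
        avgNorm p A (fun x => max (μm x) 1)) g Δ * levelMass p A n u (s + 2 * g) l / Δ ^ 2) ^ ε *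
      (energyConst m k δ (avgNorm p A (fun x => max (μ x) 1) *
        avgNorm p A (fun x => max (μm x) 1)) g Δ * levelMass p A n u (s + 2 * g) l) := by
  have hcard0 : (0 : ℝ) < A.card := by exact_mod_cast hA.card_pos
  have hn2 : 0 < n ^ 2 := by positivity
  set M := avgNorm p A (fun x => max (μ x) 1) * avgNorm p A (fun x => max (μm x) 1)
  set Λ := energyConst m k δ M g Δ with hΛ
  set Φ := levelMass p A n u (s + 2 * g) l with hΦ
  have hk0 : 0 ≤ k := by nlinarith [mul_pos hδ hΔ]
  have hΛ0 : 0 ≤ Λ := energyConst_nonneg hk0 hδ.le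
    (mul_nonneg (avgNorm_nonneg _ _ _) (avgNorm_nonneg _ _ _)) hg.le hΔ.le
  have hΦ0 : 0 ≤ Φ := levelMass_nonneg A (by linarith) l
  have hν0 := avgNorm_nonneg q A ν
  have E1 := h.energy_estimate hp hA hn hm (r := s + 2 * g) (s := s + g) (l := l) (by linarith)
    (by linarith) hr hDA hl hΔ hδ hS hk
  have E2 := h.energy_estimate hp hA hn hm (r := s + g) (s := s) (l := l + Δ) hs
    (by linarith) (by linarith) ((latBall_mono (by nlinarith)).trans hDA) (by linarith) hΔ hδ hS hk
  have eg1 : s + 2 * g - (s + g) = g := by ring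
  have eg2 : s + g - s = g := by ring
  rw [eg1] at E1
  rw [eg2] at E2
  obtain ⟨hsup, -, -⟩ := E1
  obtain ⟨-, hEc, hE⟩ := E2
  have hmono : levelMass p A n u (s + g) (l + Δ) ≤ Φ :=
    h.levelMass_mono hp A hn (by linarith) (by linarith) hr (by linarith)
  have hle : -(s * n ^ 2) ≤ 0 := by nlinarith
  set E := fun t => nnEnergy c (latBall d ((s + g) * n)) (fun x =>
      cutoff ((s + g) * n) (g * n / 2) x * max (u t x - (l + Δ + Δ)) 0) with hEdef
  set c0 := 8 * d * (1 + coInv q / coInv p) ^ 2 * avgNorm q A ν * (A.card : ℝ) ^ (2 / (d : ℝ) - 1)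
    * (Λ * Φ / Δ ^ 2) ^ ε with hc0
  have hpt : ∀ t ∈ Icc (-(s * n ^ 2)) 0,
      powMean p A (trunc (latBall d (s * n)) (l + Δ + Δ) (u t)) ≤ c0 * E t := by
    intro t ht
    have h1 := hsup t ⟨by nlinarith [ht.1], ht.2⟩
    have h2 := h.powMean_trunc_le hd hp hq hA hn (r := s + g) (s := s) (l := l + Δ) (T := Λ * Φ)
      (by linarith) ((latBall_mono (by nlinarith)).trans hDA) hΔ hε hε0 t (by rw [← mul_assoc]; exact h1)
    rw [eg2] at h2
    exact h2
  have hint : ∫ t in (-(s * n ^ 2))..0, powMean p A (trunc (latBall d (s * n)) (l + Δ + Δ) (u t)) ≤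
      c0 * ∫ t in (-(s * n ^ 2))..0, E t := by
    rw [← intervalIntegral.integral_const_mul]
    refine intervalIntegral.integral_mono_on hle ?_ ?_ hpt
    · refine ContinuousOn.intervalIntegrable ?_
      rw [uIcc_of_le hle]
      exact h.continuousOn_powMean hp A hn (by linarith) (by linarith) _
    · refine ContinuousOn.intervalIntegrable ?_
      rw [uIcc_of_le hle]
      exact continuousOn_const.mul hEc
  have hc00 : 0 ≤ c0 := by positivity
  have e2 : l + 2 * Δ = l + Δ + Δ := by ring
  rw [e2]
  calc levelMass p A n u s (l + Δ + Δ) ≤ (n ^ 2)⁻¹ * (c0 * ∫ t in (-(s * n ^ 2))..0, E t) :=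
        mul_le_mul_of_nonneg_left hint (by positivity)
    _ = c0 * ((n ^ 2)⁻¹ * ∫ t in (-(s * n ^ 2))..0, E t) := by ring
    _ ≤ c0 * (A.card * Λ * levelMass p A n u (s + g) (l + Δ) * (n ^ 2)⁻¹) :=
        mul_le_mul_of_nonneg_left hE hc00
    _ ≤ c0 * (A.card * Λ * Φ * (n ^ 2)⁻¹) := by gcongr
    _ = 8 * d * (1 + coInv q / coInv p) ^ 2 * avgNorm q A ν *
        ((A.card : ℝ) ^ (2 / (d : ℝ)) * (n ^ 2)⁻¹) * (Λ * Φ / Δ ^ 2) ^ ε * (Λ * Φ) := by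
        rw [hc0, Real.rpow_sub hcard0, Real.rpow_one]
        field_simp
    _ ≤ 8 * d * (1 + coInv q / coInv p) ^ 2 * avgNorm q A ν * 9 * (Λ * Φ / Δ ^ 2) ^ ε *
        (Λ * Φ) := by
        have : (A.card : ℝ) ^ (2 / (d : ℝ)) * (n ^ 2)⁻¹ ≤ 9 := by
          rw [← div_eq_mul_inv, div_le_iff₀ hn2]; exact hcard
        gcongr
    _ = _ := by ring

end CaloricData

/-- By induction `y i ≤ y 0 * lam ^ i`. The ratio `lam` is chosen so that `β ^ (1 + ε) * lam ^ ε =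
1`: the superlinear gain exactly cancels the growth of the constants, and the smallness of `y 0`
provides one more factor `lam`. -/
theorem tendsto_zero_of_superlinear {y : ℕ → ℝ} {K β ε : ℝ} (hy : ∀ i, 0 ≤ y i) (hK : 0 < K)
    (hβ : 1 < β) (hε : 0 < ε) (hstep : ∀ i, y (i + 1) ≤ (K * β ^ i * y i) ^ (1 + ε))
    (h0 : y 0 ^ ε * K ^ (1 + ε) ≤ β ^ (-((1 + ε) / ε))) :
    Filter.Tendsto y Filter.atTop (nhds 0) := by
  have hβ0 : 0 < β := by linarith
  set lam := β ^ (-((1 + ε) / ε)) with hlam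
  have hlam0 : 0 < lam := Real.rpow_pos_of_pos hβ0 _
  have hlam1 : lam < 1 := Real.rpow_lt_one_of_one_lt_of_neg hβ (by
    have : 0 < (1 + ε) / ε := by positivity
    linarith)
  have hlamε : β ^ (1 + ε) * lam ^ ε = 1 := by
    rw [hlam, ← Real.rpow_mul hβ0.le, ← Real.rpow_add hβ0]
    have : 1 + ε + -((1 + ε) / ε) * ε = 0 := by field_simp; ring
    rw [this, Real.rpow_zero]
  have hbound : ∀ i, y i ≤ y 0 * lam ^ i := by
    intro i
    induction i with
    | zero => simp
    | succ i ih =>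
      have hy0 := hy 0
      have hli : 0 ≤ lam ^ i := by positivity
      have hKε : 0 ≤ K ^ (1 + ε) := by positivity
      calc y (i + 1) ≤ (K * β ^ i * (y 0 * lam ^ i)) ^ (1 + ε) := by
            refine (hstep i).trans (Real.rpow_le_rpow ?_ ?_ (by linarith))
            · have := hy i
              positivity
            · gcongr
        _ = (y 0 ^ ε * K ^ (1 + ε)) * ((β ^ (1 + ε) * lam ^ ε) ^ i) * (y 0 * lam ^ i) := by
            rw [Real.mul_rpow (by positivity) (by positivity), Real.mul_rpow hK.le (by positivity),
              Real.rpow_add_of_nonneg (by positivity) zero_le_one hε.le (x := y 0 * lam ^ i),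
              Real.rpow_one, Real.mul_rpow hy0 hli, mul_pow]
            have e1 : (β ^ i) ^ (1 + ε) = (β ^ (1 + ε)) ^ i := by
              rw [← Real.rpow_natCast, ← Real.rpow_natCast, ← Real.rpow_mul hβ0.le,
                ← Real.rpow_mul hβ0.le, mul_comm]
            have e2 : (lam ^ i) ^ ε = (lam ^ ε) ^ i := by
              rw [← Real.rpow_natCast, ← Real.rpow_natCast, ← Real.rpow_mul hlam0.le,
                ← Real.rpow_mul hlam0.le, mul_comm]
            rw [e1, e2]
            ring
        _ = (y 0 ^ ε * K ^ (1 + ε)) * (y 0 * lam ^ i) := by rw [hlamε, one_pow, mul_one]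
        _ ≤ lam * (y 0 * lam ^ i) := by gcongr
        _ = y 0 * lam ^ (i + 1) := by ring
  have hlim : Filter.Tendsto (fun i => y 0 * lam ^ i) Filter.atTop (nhds 0) := by
    simpa using (tendsto_pow_atTop_nhds_zero_of_lt_one hlam0.le hlam1).const_mul (y 0)
  exact squeeze_zero hy hbound hlim

end

/-! ### The dyadic recursion and the upper bound it yields -/

section

variable {d : ℕ}

/-- The dimensional constant of the De Giorgi recursion. -/
noncomputable def recursionConst (d : ℕ) (p q : ℝ≥0∞) (m : ℝ) : ℝ :=
  72 * d * (1 + coInv q / coInv p) ^ 2 * (1536 * 8 ^ m)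

/-- Each scale costs `2 ^ m` from the cutoff and `2 ^ 4` otherwise: one factor `2` from `g⁻¹`, one
from `k / Δ` and two from `Δ⁻²`. -/
theorem energyConst_dyadic {m k δ M τ : ℝ} (hk : 0 < k) (hδ : 0 < δ) (hτ : 0 < τ) (i : ℕ) :
    energyConst m k δ M (τ / (4 * 2 ^ i)) (k / (4 * 2 ^ i)) / (k / (4 * 2 ^ i)) ^ 2 =
      1536 * 8 ^ m * (M / (δ * τ ^ (m + 1))) * (2 ^ m * 16) ^ i / k ^ 2 := by
  have hz0 : (0 : ℝ) < 2 ^ i := by positivity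
  have e1 : (2 / (τ / (4 * 2 ^ i))) ^ m = 8 ^ m * (2 ^ m) ^ i * (τ ^ m)⁻¹ := by
    have : 2 / (τ / (4 * 2 ^ i)) = 8 * 2 ^ i / τ := by field_simp; norm_num
    rw [this, Real.div_rpow (by positivity) hτ.le, Real.mul_rpow (by norm_num) hz0.le,
      ← Real.rpow_natCast, ← Real.rpow_natCast, ← Real.rpow_mul (by norm_num),
      ← Real.rpow_mul (by norm_num), mul_comm (i : ℝ) m]
    rfl
  have e2 : τ ^ (m + 1) = τ ^ m * τ := Real.rpow_add_one hτ.ne' m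
  have hτm : 0 < τ ^ m := Real.rpow_pos_of_pos hτ m
  have e3 : (2 ^ m * 16 : ℝ) ^ i = (2 ^ m) ^ i * (2 ^ i) ^ 4 := by
    rw [mul_pow, ← pow_mul 2 i 4, mul_comm i 4, pow_mul]
    norm_num
  rw [energyConst, e1, e2, e3]
  generalize (2 : ℝ) ^ i = z at hz0
  generalize ((2 : ℝ) ^ m) ^ i = y
  generalize (8 : ℝ) ^ m = x
  generalize τ ^ m = w at hτm
  field_simp
  ring

theorem div_sq_le_rpow_of_le {y B w Δ k ε : ℝ} (hB : 1 ≤ B) (hw : 0 ≤ w) (hΔ : 0 < Δ)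
    (hΔk : Δ ≤ k) (hε : 0 < ε) (hy : y ≤ B * (w / Δ ^ 2) ^ ε * w) :
    y / k ^ 2 ≤ (B * (w / Δ ^ 2)) ^ (1 + ε) := by
  have hk : 0 < k := hΔ.trans_le hΔk
  have ha0 : 0 ≤ w / Δ ^ 2 := by positivity
  calc y / k ^ 2 ≤ B * (w / Δ ^ 2) ^ ε * w / k ^ 2 :=
        div_le_div_of_nonneg_right hy (by positivity)
    _ = B * (w / Δ ^ 2) ^ ε * (w / k ^ 2) := by ring
    _ ≤ B * (w / Δ ^ 2) ^ ε * (w / Δ ^ 2) := by gcongr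
    _ = B * (w / Δ ^ 2) ^ (1 + ε) := by
        rw [Real.rpow_add_of_nonneg ha0 zero_le_one hε.le, Real.rpow_one]; ring
    _ ≤ B ^ (1 + ε) * (w / Δ ^ 2) ^ (1 + ε) :=
        mul_le_mul_of_nonneg_right (Real.self_le_rpow_of_one_le hB (by linarith))
          (Real.rpow_nonneg ha0 _)
    _ = _ := (Real.mul_rpow (by linarith) ha0).symm

namespace CaloricData

variable {c : ZGrid d → ZGrid d → ℝ} {μ μm ν : ZGrid d → ℝ} {m n S : ℝ}
  {u : ℝ → ZGrid d → ℝ}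

theorem levelMass_recursion (h : CaloricData c μ μm ν m n S u) (hd : 2 ≤ d) {p q : ℝ≥0∞}
    (hp : 1 < p) (hq : 1 < q) {A : Finset (ZGrid d)} (hA : A.Nonempty) (hν : ∀ x, 1 ≤ ν x)
    (hn : 0 < n) (hm : 2 ≤ m) (hcard : (A.card : ℝ) ^ (2 / (d : ℝ)) ≤ 9 * n ^ 2)
    {θ' θ k δ ε : ℝ} (hθ' : 0 < θ') (hθ : θ' < θ) (hθ1 : θ < 1) (hDA : latBall d (θ * n) ⊆ A)
    (hk : 0 < k) (hδ : 0 < δ) (hδ2 : δ < 2) (hS : S * n ^ 2 * δ ≤ k * n ^ m)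
    (hε : ε = coInv p + coInv q - 2 + 2 / d) (hε0 : 0 < ε) (i : ℕ) :
    levelMass p A n u (θ' + (θ - θ') / 2 ^ (i + 1)) (k - k / 2 ^ (i + 1)) / k ^ 2 ≤
      (recursionConst d p q m * (avgNorm p A (fun x => max (μ x) 1) *
          avgNorm p A (fun x => max (μm x) 1) * avgNorm q A ν / (δ * (θ - θ') ^ (m + 1))) *
        (2 ^ m * 16) ^ i *
        (levelMass p A n u (θ' + (θ - θ') / 2 ^ i) (k - k / 2 ^ i) / k ^ 2)) ^ (1 + ε) := by
  set τ := θ - θ' with hτ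
  have hτ0 : 0 < τ := sub_pos.2 hθ
  set M := avgNorm p A (fun x => max (μ x) 1) * avgNorm p A (fun x => max (μm x) 1) with hM
  set V := avgNorm q A ν with hV
  have hM0 : 0 ≤ M := mul_nonneg (avgNorm_nonneg _ _ _) (avgNorm_nonneg _ _ _)
  have hV1 : 1 ≤ V := one_le_avgNorm (zero_lt_one.trans hq).ne' hA fun x _ => hν x
  set z : ℝ := 2 ^ i with hz
  have hz1 : 1 ≤ z := one_le_pow₀ (by norm_num)
  have hz0 : 0 < z := by linarith
  have hz' : (2 : ℝ) ^ (i + 1) = 2 * z := by rw [pow_succ]; ring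
  rw [hz']
  -- One dyadic step shrinks the size by `τ / (2z)` and raises the level by `k / (2z)`. Each is
  -- split into two equal halves, for the two energy estimates.
  set g := τ / (4 * z) with hg
  set Δ := k / (4 * z) with hΔ
  have hg0 : 0 < g := by positivity
  have hΔ0 : 0 < Δ := by positivity
  have es : θ' + τ / (2 * z) + 2 * g = θ' + τ / z := by rw [hg]; field_simp; ring
  have el : k - k / z + 2 * Δ = k - k / (2 * z) := by rw [hΔ]; field_simp; ring
  have hτz : τ / z ≤ τ := div_le_self hτ0.le hz1
  have hkz : k / z ≤ k := div_le_self hk.le hz1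
  have hΔk : Δ ≤ k := div_le_self hk.le (by linarith)
  have hδΔ : δ * Δ ≤ 2 * k := mul_le_mul hδ2.le hΔk hΔ0.le (by norm_num)
  have hstep := h.levelMass_step hd hp hq hA hn hm hcard (s := θ' + τ / (2 * z)) (g := g)
    (l := k - k / z) (Δ := Δ) (by positivity) hg0 (by rw [es]; linarith)
    ((latBall_mono (by rw [es]; exact mul_le_mul_of_nonneg_right (by linarith) hn.le)).trans hDA)
    (by linarith) hΔ0 hδ hS hδΔ hε hε0
  rw [es, el] at hstep
  set Φ := levelMass p A n u (θ' + τ / z) (k - k / z) with hΦ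
  have hΦ0 : 0 ≤ Φ := levelMass_nonneg A (by positivity) _
  set Λ := energyConst m k δ M g Δ with hΛ
  have hΛ0 : 0 ≤ Λ := energyConst_nonneg hk.le hδ.le hM0 hg0.le hΔ0.le
  set C₁ := 72 * d * (1 + coInv q / coInv p) ^ 2 with hC₁
  have hC₁1 : 1 ≤ C₁ := by
    have h1 : (2 : ℝ) ≤ d := by exact_mod_cast hd
    have h2 : 0 < coInv q / coInv p := div_pos (coInv_pos hq) (coInv_pos hp)
    have h3 : 1 ≤ (1 + coInv q / coInv p) ^ 2 := one_le_pow₀ (by linarith)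
    rw [hC₁]
    nlinarith
  refine (div_sq_le_rpow_of_le (one_le_mul_of_one_le_of_one_le hC₁1 hV1)
    (mul_nonneg hΛ0 hΦ0) hΔ0 hΔk hε0 hstep).trans (le_of_eq ?_)
  congr 1
  have e := energyConst_dyadic (m := m) (M := M) hk hδ hτ0 i
  have e' : Λ * Φ / Δ ^ 2 = Λ / Δ ^ 2 * Φ := by ring
  rw [e', e, recursionConst]
  ring

theorem le_of_levelMass_le (h : CaloricData c μ μm ν m n S u) (hd : 2 ≤ d) {p q : ℝ≥0∞}
    (hp : 1 < p) (hq : 1 < q) {A : Finset (ZGrid d)} (hA : A.Nonempty) (hν : ∀ x, 1 ≤ ν x)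
    (hn : 0 < n) (hm : 2 ≤ m) (hcard : (A.card : ℝ) ^ (2 / (d : ℝ)) ≤ 9 * n ^ 2)
    {θ' θ k δ ε X : ℝ} (hθ' : 0 < θ') (hθ : θ' < θ) (hθ1 : θ < 1) (hDA : latBall d (θ * n) ⊆ A)
    (hk : 0 < k) (hδ : 0 < δ) (hδ2 : δ < 2) (hS : S * n ^ 2 * δ ≤ k * n ^ m)
    (hε : ε = coInv p + coInv q - 2 + 2 / d) (hε0 : 0 < ε)
    (hX0 : 0 < X) (hX : avgNorm p A (fun x => max (μ x) 1) *
      avgNorm p A (fun x => max (μm x) 1) * avgNorm q A ν / (δ * (θ - θ') ^ (m + 1)) ≤ X)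
    (h0 : (levelMass p A n u θ 0 / k ^ 2) ^ ε * (recursionConst d p q m * X) ^ (1 + ε) ≤
      (2 ^ m * 16) ^ (-((1 + ε) / ε))) {t : ℝ} (ht : t ∈ Icc (-(θ' * n ^ 2)) 0) {x : ZGrid d}
    (hx : x ∈ latBall d (θ' * n)) : u t x ≤ k := by
  have hb := coInv_pos hp
  have hb' := coInv_pos hq
  have hd0 : (0 : ℝ) < d := by positivity
  have hrec : 0 < recursionConst d p q m := by
    have : (0 : ℝ) < 8 ^ m := by positivity
    unfold recursionConst
    positivity
  have hτ0 : 0 < θ - θ' := sub_pos.2 hθ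
  have hy0 : ∀ i : ℕ, 0 ≤ levelMass p A n u (θ' + (θ - θ') / 2 ^ i) (k - k / 2 ^ i) / k ^ 2 :=
    fun i => div_nonneg (levelMass_nonneg A (by positivity) _) (by positivity)
  have hlim := tendsto_zero_of_superlinear
    (y := fun i => levelMass p A n u (θ' + (θ - θ') / 2 ^ i) (k - k / 2 ^ i) / k ^ 2)
    (K := recursionConst d p q m * X) (β := 2 ^ m * 16) (ε := ε) hy0 (by positivity)
    (by
      have : (1 : ℝ) ≤ 2 ^ m := Real.one_le_rpow (by norm_num) (by linarith)
      linarith) hε0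
    (fun i => by
      refine (h.levelMass_recursion hd hp hq hA hν hn hm hcard hθ' hθ hθ1 hDA hk hδ hδ2 hS hε
        hε0 i).trans ?_
      have := hy0 i
      have hnn : 0 ≤ avgNorm p A (fun x => max (μ x) 1) *
          avgNorm p A (fun x => max (μm x) 1) * avgNorm q A ν / (δ * (θ - θ') ^ (m + 1)) :=
        div_nonneg (mul_nonneg (mul_nonneg (avgNorm_nonneg _ _ _) (avgNorm_nonneg _ _ _))
          (avgNorm_nonneg _ _ _)) (by positivity)
      gcongr)
    (by simpa using h0)
  -- The mass at the limiting size and level is below every term of the sequence.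
  have hzero : levelMass p A n u θ' k = 0 := by
    refine le_antisymm ?_ (levelMass_nonneg A hθ'.le k)
    have h1 : levelMass p A n u θ' k / k ^ 2 ≤ 0 := by
      refine ge_of_tendsto' hlim fun i => div_le_div_of_nonneg_right ?_ (by positivity)
      have hpos : 0 < (θ - θ') / 2 ^ i := by positivity
      have hle : (θ - θ') / 2 ^ i ≤ θ - θ' := div_le_self hτ0.le (one_le_pow₀ (by norm_num))
      have hkp : 0 < k / 2 ^ i := by positivity
      exact h.levelMass_mono hp A hn hθ' (by linarith) (by linarith) (by linarith)
    have h2 : (0 : ℝ) < k ^ 2 := by positivity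
    by_contra! h3
    exact absurd (div_pos h3 h2) (not_lt.2 h1)
  have hn2 : 0 < n ^ 2 := by positivity
  have hlt : -(θ' * n ^ 2) < 0 := by
    have := mul_pos hθ' hn2
    linarith
  have hcont := h.continuousOn_powMean hp A hn (r := θ') (r' := θ') (by linarith) (by linarith) k
  have hint : ∫ t in Icc (-(θ' * n ^ 2)) 0,
      powMean p A (trunc (latBall d (θ' * n)) k (u t)) = 0 := by
    rw [integral_Icc_eq_integral_Ioc, ← intervalIntegral.integral_of_le hlt.le]
    rw [levelMass] at hzero
    exact (mul_eq_zero.1 hzero).resolve_left (by positivity)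
  rw [integral_eq_zero_iff_of_nonneg (fun t => powMean_nonneg p A (trunc_nonneg _ _ _))
    hcont.integrableOn_Icc] at hint
  -- Continuity in time upgrades vanishing almost everywhere to every `t`, including the endpoints.
  have heq := Measure.eqOn_Icc_of_ae_eq volume hlt.ne hint hcont continuousOn_const ht
  have hcard0 : (0 : ℝ) < A.card := by exact_mod_cast hA.card_pos
  have hxA : x ∈ A := hDA (latBall_mono (by nlinarith) hx)
  simp only [Pi.zero_apply] at heq
  have hnnx : ∀ x ∈ A, 0 ≤ trunc (latBall d (θ' * n)) k (u t) x ^ (2 / coInv p) := fun x _ =>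
    Real.rpow_nonneg (trunc_nonneg _ _ _ x) _
  rw [powMean, Real.rpow_eq_zero (mul_nonneg (by positivity) (Finset.sum_nonneg hnnx)) hb.ne',
    mul_eq_zero, or_iff_right (by positivity), Finset.sum_eq_zero_iff_of_nonneg hnnx] at heq
  have h3 := heq x hxA
  rw [Real.rpow_eq_zero (trunc_nonneg _ _ _ x) (by positivity), trunc, if_pos hx] at h3
  by_contra! hc
  have := le_max_left (u t x - k) 0
  linarith

theorem neg (h : CaloricData c μ μm ν m n S u) :
    CaloricData c μ μm ν m n S (fun t x => -u t x) where
  nonneg := h.nonneg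
  symm := h.symm
  summable := h.summable
  hasSum_two := h.hasSum_two
  hasSum_moment := h.hasSum_moment
  unitVec_pos := h.unitVec_pos
  inv_le := h.inv_le
  bound t ht x := by rw [abs_neg]; exact h.bound t ht x
  deriv t ht x hx := by
    refine (h.deriv t ht x hx).fun_neg.congr_deriv ?_
    rw [← tsum_neg]
    exact tsum_congr fun y => by ring

/-- At level `0` the truncation is at most `|u|`. The mass is normalised by `n²` and the norm by the
true length `θ n²` of the interval, which only helps as `θ < 1`. -/
theorem levelMass_le_parNorm_sq (h : CaloricData c μ μm ν m n S u) {p : ℝ≥0∞}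
    (hp : 1 < p) (hn : 0 < n) {θ : ℝ} (hθ0 : 0 < θ) (hθ : θ < 1) :
    levelMass p (latBall d (θ * n)) n u θ 0 ≤
      parNorm (2 * p.conjExponent) 2 (Icc (-(θ * n ^ 2)) 0) (latBall d (θ * n)) u ^ 2 := by
  have hb := coInv_pos hp
  have hn2 : 0 < n ^ 2 := by positivity
  have hθn : 0 < θ * n ^ 2 := by positivity
  set A := latBall d (θ * n) with hA
  have hcont : ContinuousOn (fun t => powMean p A fun x => |u t x|) (Icc (-(θ * n ^ 2)) 0) := by
    refine ContinuousOn.rpow_const ?_ fun _ _ => Or.inr hb.le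
    refine continuousOn_const.mul (continuousOn_finsetSum _ fun x hx => ?_)
    exact (h.continuousOn hn hθ (latBall_mono (by nlinarith) hx)).abs.rpow_const
      fun _ _ => Or.inr (by positivity)
  have hnn : ∀ t, 0 ≤ powMean p A fun x => |u t x| := fun t =>
    powMean_nonneg p A fun x => abs_nonneg _
  have hpar : parNorm (2 * p.conjExponent) 2 (Icc (-(θ * n ^ 2)) 0) A u ^ 2 =
      (θ * n ^ 2)⁻¹ * ∫ t in (-(θ * n ^ 2))..0, powMean p A fun x => |u t x| := by
    have hint : ∫ t in Icc (-(θ * n ^ 2)) 0, avgNorm (2 * p.conjExponent) A (u t) ^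
        (2 : ℝ≥0∞).toReal = ∫ t in (-(θ * n ^ 2))..0, powMean p A fun x => |u t x| := by
      rw [integral_Icc_eq_integral_Ioc, ← intervalIntegral.integral_of_le (by linarith)]
      refine intervalIntegral.integral_congr fun t _ => ?_
      exact avgNorm_two_mul_conjExponent_sq hp A (u t)
    have hvol : volume.real (Icc (-(θ * n ^ 2)) 0) = θ * n ^ 2 := by
      rw [Real.volume_real_Icc_of_le (by linarith)]; ring
    have hI : 0 ≤ ∫ t in (-(θ * n ^ 2))..0, powMean p A fun x => |u t x| :=
      intervalIntegral.integral_nonneg (by linarith) fun t _ => hnn t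
    rw [parNorm, if_neg (by simp), hint, hvol, ← Real.rpow_two, ← Real.rpow_mul (by positivity)]
    simp
  rw [hpar, levelMass]
  have hle : ∫ t in (-(θ * n ^ 2))..0, powMean p A (trunc A 0 (u t)) ≤
      ∫ t in (-(θ * n ^ 2))..0, powMean p A fun x => |u t x| := by
    refine intervalIntegral.integral_mono_on (by linarith) ?_ ?_ fun t _ =>
      powMean_mono hp A (trunc_nonneg _ _ _) fun x => ?_
    · refine ContinuousOn.intervalIntegrable ?_
      rw [uIcc_of_le (by linarith)]
      exact h.continuousOn_powMean hp A hn hθ hθ.le 0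
    · refine ContinuousOn.intervalIntegrable ?_
      rw [uIcc_of_le (by linarith)]
      exact hcont
    · unfold trunc
      split_ifs
      · rw [sub_zero]
        exact max_le (le_abs_self _) (abs_nonneg _)
      · exact abs_nonneg _
  refine mul_le_mul ?_ hle (intervalIntegral.integral_nonneg (by linarith) fun t _ =>
    powMean_nonneg p A (trunc_nonneg _ _ _)) (by positivity)
  exact inv_anti₀ hθn (by nlinarith)

end CaloricData

theorem card_latBall_rpow_le (hd : 0 < d) {R n : ℝ} (hn : 1 ≤ n) (hR : 0 ≤ R) (hRn : R ≤ n) :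
    ((latBall d R).card : ℝ) ^ (2 / (d : ℝ)) ≤ 9 * n ^ 2 := by
  have hfl : (0 : ℤ) ≤ ⌊R⌋ := Int.floor_nonneg.2 hR
  have h1 : (latBall d R).card ≤ (2 * ⌊R⌋ + 1).toNat ^ d := by
    classical
    refine (Finset.card_filter_le _ _).trans (le_of_eq ?_)
    rw [Pi.card_Icc]
    simp only [Int.card_Icc, Finset.prod_const, Finset.card_univ, Fintype.card_fin]
    congr 2
    ring
  have h2 : ((2 * ⌊R⌋ + 1).toNat : ℝ) ≤ 3 * n := by
    have e : (((2 * ⌊R⌋ + 1).toNat : ℤ) : ℝ) = 2 * (⌊R⌋ : ℝ) + 1 := by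
      rw [Int.toNat_of_nonneg (by omega)]; push_cast; ring
    have := Int.floor_le R
    rw [Int.cast_natCast] at e
    rw [e]
    linarith
  have h3 : ((latBall d R).card : ℝ) ≤ (3 * n) ^ d := by
    calc ((latBall d R).card : ℝ) ≤ ((2 * ⌊R⌋ + 1).toNat : ℝ) ^ d := by exact_mod_cast h1
      _ ≤ _ := pow_le_pow_left₀ (by positivity) h2 d
  calc ((latBall d R).card : ℝ) ^ (2 / (d : ℝ)) ≤ ((3 * n) ^ d) ^ (2 / (d : ℝ)) :=
        Real.rpow_le_rpow (by positivity) h3 (by positivity)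
    _ = (3 * n) ^ (2 : ℝ) := by
        rw [← Real.rpow_natCast, ← Real.rpow_mul (by positivity)]
        congr 1
        have : (d : ℝ) ≠ 0 := by positivity
        field_simp
    _ = 9 * n ^ 2 := by rw [Real.rpow_two]; ring

end

/-! ### Moments of the random conductances at every site -/

namespace RandomConductance

variable {d : ℕ} {Ω : Type*} [MeasurableSpace Ω] {P : Measure Ω}

/-- Stationarity is formulated for images; the bad set for `τ x` is the image of `sᶜ` under `τ
(-x)`. -/
theorem ae_comp_τ (E : RandomConductance d Ω P) {s : Set Ω} (hs : MeasurableSet s)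
    (h : ∀ᵐ ω ∂P, ω ∈ s) (x : ZGrid d) : ∀ᵐ ω ∂P, E.τ x ω ∈ s := by
  have h1 : {ω | ¬E.τ x ω ∈ s} = E.τ (-x) '' sᶜ := by
    have hinv : ∀ y ω, E.τ y (E.τ (-y) ω) = ω := fun y ω => by
      have := congrFun (E.τ_add y (-y)) ω
      rw [add_neg_cancel, E.τ_zero] at this
      exact this.symm
    ext ω
    constructor
    · intro hω
      exact ⟨E.τ x ω, hω, by simpa using hinv (-x) ω⟩
    · rintro ⟨ω', hω', rfl⟩
      change ¬E.τ x (E.τ (-x) ω') ∈ s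
      rw [hinv]
      exact hω'
  rw [ae_iff, h1, E.stationary _ _ hs.compl]
  exact h

theorem measurable_moment (E : RandomConductance d Ω P) (m : ℝ) : Measurable (E.moment m) :=
  Measurable.tsum fun z => measurable_const.mul (E.measurable_C 0 z).coe_nnreal_ennreal

theorem measurable_invMoment (E : RandomConductance d Ω P) : Measurable E.invMoment :=
  Measurable.tsum fun z => (E.measurable_C 0 z.1).coe_nnreal_ennreal.inv

theorem ae_lt_top_of_memLp [IsProbabilityMeasure P] {f : Ω → ℝ≥0∞} (hf : Measurable f)
    {p : ℝ≥0∞} (hp : 1 ≤ p) (h : MemLp f p P) : ∀ᵐ ω ∂P, f ω < ∞ := by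
  have h1 := (h.mono_exponent hp).eLpNorm_lt_top
  rw [eLpNorm_one_eq_lintegral_enorm] at h1
  exact ae_lt_top hf (by simpa using h1.ne)

theorem hasSum_mu (E : RandomConductance d Ω P) {m : ℝ} {ω : Ω} {x : ZGrid d}
    (h : E.moment m (E.τ x ω) < ∞) :
    HasSum (fun y => eucl (y - x) ^ m * (E.C x y ω : ℝ)) (E.mu m ω x) := by
  have h1 : HasSum (fun z => (ENNReal.ofReal (eucl z ^ m) *
      (E.C 0 z (E.τ x ω) : ℝ≥0∞)).toReal) (E.mu m ω x) := by
    unfold mu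
    rw [moment, ENNReal.tsum_toReal_eq fun z => ?_]
    · exact ENNReal.hasSum_toReal h.ne
    · exact ENNReal.mul_ne_top ENNReal.ofReal_ne_top ENNReal.coe_ne_top
  rw [← (Equiv.subRight x).hasSum_iff] at h1
  refine h1.congr_fun fun y => ?_
  simp only [Function.comp_apply, Equiv.subRight_apply, ENNReal.toReal_mul,
    ENNReal.coe_toReal]
  rw [ENNReal.toReal_ofReal (Real.rpow_nonneg (eucl_nonneg _) _), ← E.covariant, zero_add,
    sub_add_cancel]

theorem inv_C_le_nu (E : RandomConductance d Ω P) {ω : Ω} {x : ZGrid d}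
    (h : E.invMoment (E.τ x ω) < ∞) (j : Fin d × ℤˣ) :
    0 < (E.C x (x + unitVec j) ω : ℝ) ∧ (E.C x (x + unitVec j) ω : ℝ)⁻¹ ≤ E.nu ω x := by
  have h1 : (E.C 0 (unitVec j) (E.τ x ω) : ℝ≥0∞)⁻¹ ≤ E.invMoment (E.τ x ω) :=
    ENNReal.le_tsum (f := fun z : {z : ZGrid d // eucl z = 1} =>
      (E.C 0 z.1 (E.τ x ω) : ℝ≥0∞)⁻¹) ⟨unitVec j, eucl_unitVec j⟩
  rw [← E.covariant, zero_add, add_comm (unitVec j) x] at h1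
  refine ⟨?_, ?_⟩
  · have h2 := ENNReal.inv_ne_top.1 (h1.trans_lt h).ne
    have h3 : E.C x (x + unitVec j) ω ≠ 0 := by simpa using h2
    exact NNReal.coe_pos.2 (pos_iff_ne_zero.2 h3)
  · have := ENNReal.toReal_mono h.ne h1
    simpa [ENNReal.toReal_inv, nu] using this

/-- Only the smaller cylinder `(-n², 0] × B_n` is kept. Replacing `ν` by `max ν 1` makes its norm at
least `1`, as the recursion requires, and matches `momentFactor`. -/
theorem caloricData (E : RandomConductance d Ω P) {ω : Ω} {m : ℝ} {n : ℕ} (hn : 1 ≤ n)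
    (hπ : ∀ x, ∑' y, (E.C x y ω : ℝ≥0∞) < ∞) (h2 : ∀ x, E.moment 2 (E.τ x ω) < ∞)
    (hm : ∀ x, E.moment m (E.τ x ω) < ∞) (hν : ∀ x, E.invMoment (E.τ x ω) < ∞)
    {u : ℝ → ZGrid d → ℝ}
    (hu : ∃ K : ℝ, ∀ t ∈ Ioc (-(4 * (n : ℝ) ^ 2)) 0, ∀ x, |u t x| ≤ K)
    (hcal : E.IsCaloric ω (4 * (n : ℝ) ^ 2) (2 * n) u) :
    CaloricData (fun x y => (E.C x y ω : ℝ)) (E.mu 2 ω) (E.mu m ω) (fun x => max (E.nu ω x) 1)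
      m n (globalSup ((n : ℝ) ^ 2) u) u := by
  have hn2 : 0 ≤ (n : ℝ) ^ 2 := by positivity
  have hsub : Ioc (-(n : ℝ) ^ 2) 0 ⊆ Ioc (-(4 * (n : ℝ) ^ 2)) 0 :=
    Ioc_subset_Ioc_left (by linarith)
  refine ⟨fun x y => NNReal.coe_nonneg _, fun x y => by rw [E.symm], fun x => ?_,
    fun x => E.hasSum_mu (h2 x), fun x => E.hasSum_mu (hm x), fun x j => (E.inv_C_le_nu (hν x) j).1,
    fun x j => (E.inv_C_le_nu (hν x) j).2.trans (le_max_left _ _), fun t ht x => ?_,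
    fun t ht x hx => ?_⟩
  · exact NNReal.summable_coe.2 (ENNReal.tsum_coe_ne_top_iff_summable.1 (hπ x).ne)
  · obtain ⟨K, hK⟩ := hu
    refine le_ciSup (f := fun z : Ioc (-(n : ℝ) ^ 2) (0 : ℝ) × ZGrid d => |u z.1 z.2|) ?_
      (⟨t, ht⟩, x)
    refine ⟨K, ?_⟩
    rintro _ ⟨z, rfl⟩
    exact hK z.1 (hsub z.1.2) z.2
  · have hn0 : (0 : ℝ) ≤ n := by positivity
    exact (hcal t (hsub ht) x (latBall_mono (by linarith) hx)).mono hsub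

end RandomConductance

/-! ### The maximal inequality -/

theorem theorem3 {d : ℕ} (hd : 2 ≤ d) {Ω : Type*} [MeasurableSpace Ω] (P : Measure Ω)
    [IsProbabilityMeasure P] (E : RandomConductance d Ω P)
    (p q : ℝ≥0∞) (hp : 1 < p) (hq : 1 < q)
    (hpq : (1 - 1 / (d : ℝ)) * (1 / p).toReal + (1 / q).toReal ≤ 1 / (d : ℝ))
    (hμ : MemLp (E.moment 2) p P) (hν : MemLp E.invMoment q P)
    (m : ℝ) (hm : 2 ≤ m) (hμm : MemLp (E.moment m) p P) :
    ∃ C κ : ℝ, 0 < C ∧ 0 < κ ∧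
      ∃ N₀ : Ω → ℝ, Measurable N₀ ∧ (∀ ω, 0 < N₀ ω) ∧
        ∀ᵐ ω ∂P, ∀ n : ℕ, N₀ ω < (n : ℝ) →
          ∀ u : ℝ → ZGrid d → ℝ,
            (∃ K : ℝ, ∀ t ∈ Ioc (-(4 * (n : ℝ) ^ 2)) 0, ∀ x, |u t x| ≤ K) →
            E.IsCaloric ω (4 * (n : ℝ) ^ 2) (2 * n) u →
            ∀ δ θ' θ : ℝ, 0 < δ → δ < 2 → 1 / 2 ≤ θ' → θ' < θ → θ < 1 →
              ∀ t ∈ Icc (-(θ' * (n : ℝ) ^ 2)) 0, ∀ x ∈ latBall d (θ' * n),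
                |u t x| ≤
                  δ * (n : ℝ) ^ (-(m - 2)) * globalSup ((n : ℝ) ^ 2) u +
                  C * (E.momentFactor p q m ω (θ * n) / (δ * (θ - θ') ^ (m + 3))) ^ κ *
                    parNorm (2 * p.conjExponent) 2 (Icc (-(θ * (n : ℝ) ^ 2)) 0)
                      (latBall d (θ * n)) u := by
  have hd2 : (2 : ℝ) ≤ d := by exact_mod_cast hd
  have hd0 : (0 : ℝ) < d := by linarith
  have hb := coInv_pos hp
  have hb' := coInv_pos hq
  obtain ⟨ε, hε⟩ : ∃ ε, ε = coInv p + coInv q - 2 + 2 / d := ⟨_, rfl⟩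
  -- Here `ε = 2/d - 1/p - 1/q`; the hypothesis gives `1/p + 1/q ≤ 1/d + 1/(dp)`, which is less than
  -- `2/d` because `p > 1`.
  have hε0 : 0 < ε := by
    have h1 : 1 / (d : ℝ) * (1 / p).toReal < 1 / (d : ℝ) * 1 :=
      mul_lt_mul_of_pos_left (by unfold coInv at hb; linarith) (by positivity)
    have h2 : 2 / (d : ℝ) = 1 / (d : ℝ) + 1 / (d : ℝ) := by ring
    rw [hε, h2]
    unfold coInv
    linarith
  set C₃ := recursionConst d p q m with hC₃
  have hC₃0 : 0 < C₃ := by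
    have : (0 : ℝ) < 8 ^ m := by positivity
    rw [hC₃, recursionConst]
    positivity
  set β : ℝ := 2 ^ m * 16 with hβ
  have hβ0 : 0 < β := by positivity
  -- `C` and `κ` solve `(C X^κ)^{2ε} = (C₃ X)^{1+ε} β^{(1+ε)/ε}`, the equality case of the smallness
  -- condition on the initial mass.
  set C := (C₃ ^ (1 + ε) * β ^ ((1 + ε) / ε)) ^ (1 / (2 * ε)) with hC
  have hC0 : 0 < C := by positivity
  set κ := (1 + ε) / (2 * ε) with hκ
  have hκ0 : 0 < κ := by positivity
  -- The estimate holds for every `n ≥ 1`, so the threshold `1/2` serves only to exclude `n = 0`.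
  refine ⟨C, κ, hC0, hκ0, fun _ => 1 / 2, measurable_const, fun _ => by norm_num, ?_⟩
  have hA2 := ae_all_iff.2 fun x => E.ae_comp_τ (measurableSet_lt (E.measurable_moment 2)
    measurable_const) (RandomConductance.ae_lt_top_of_memLp (E.measurable_moment 2) hp.le hμ) x
  have hAm := ae_all_iff.2 fun x => E.ae_comp_τ (measurableSet_lt (E.measurable_moment m)
    measurable_const) (RandomConductance.ae_lt_top_of_memLp (E.measurable_moment m) hp.le hμm) x
  have hAν := ae_all_iff.2 fun x => E.ae_comp_τ (measurableSet_lt E.measurable_invMoment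
    measurable_const) (RandomConductance.ae_lt_top_of_memLp E.measurable_invMoment hq.le hν) x
  filter_upwards [hA2, hAm, hAν, E.total_weight] with ω h2 hm' hν' hπ
  intro n hn u hu hcal δ θ' θ hδ hδ2 hθ' hθ hθ1 t ht x hx
  have hn1 : 1 ≤ n := by
    by_contra! h0
    have : n = 0 := by omega
    subst this
    norm_num at hn
  have hnR : (1 : ℝ) ≤ n := by exact_mod_cast hn1
  have hn0 : (0 : ℝ) < n := by linarith
  have hdata := E.caloricData hn1 (fun x => (hπ x).2) h2 hm' hν' hu hcal
  set S := globalSup ((n : ℝ) ^ 2) u with hS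
  set A := latBall d (θ * n) with hA
  have hθn : 0 ≤ θ * n := by have : 0 < θ := by linarith
                             positivity
  have hAne : A.Nonempty := ⟨0, by rw [hA, mem_latBall]; simpa [eucl] using hθn⟩
  have hcard := card_latBall_rpow_le (d := d) (by omega) hnR hθn (by nlinarith)
  set W := parNorm (2 * p.conjExponent) 2 (Icc (-(θ * (n : ℝ) ^ 2)) 0) A u with hW
  have hM1 : 1 ≤ E.momentFactor p q m ω (θ * n) := by
    have hp0 : p ≠ 0 := (zero_lt_one.trans hp).ne'
    have hq0 : q ≠ 0 := (zero_lt_one.trans hq).ne'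
    have h1 := one_le_avgNorm hp0 hAne (f := fun x => max (E.mu 2 ω x) 1)
      fun x _ => le_max_right _ _
    have h2 := one_le_avgNorm hp0 hAne (f := fun x => max (E.mu m ω x) 1)
      fun x _ => le_max_right _ _
    have h3 := one_le_avgNorm hq0 hAne (f := fun x => max (E.nu ω x) 1)
      fun x _ => le_max_right _ _
    exact one_le_mul_of_one_le_of_one_le (one_le_mul_of_one_le_of_one_le h1 h2) h3
  set M := E.momentFactor p q m ω (θ * n) with hM
  have hτ0 : 0 < θ - θ' := sub_pos.2 hθ
  set X := M / (δ * (θ - θ') ^ (m + 3)) with hX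
  have hX0 : 0 < X := by positivity
  -- The iteration needs only the power `m + 1` of `θ - θ'`; since `θ - θ' < 1`, the power `m + 3`
  -- gives a larger bound.
  have hXle : M / (δ * (θ - θ') ^ (m + 1)) ≤ X := by
    refine div_le_div_of_nonneg_left (by linarith) (by positivity)
      (mul_le_mul_of_nonneg_left ?_ hδ.le)
    exact Real.rpow_le_rpow_of_exponent_ge hτ0 (by linarith) (by linarith)
  have hW0 : 0 ≤ W := by
    rw [hW, parNorm, if_neg (by simp)]
    exact Real.rpow_nonneg (mul_nonneg (by positivity) (integral_nonneg fun t =>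
      Real.rpow_nonneg (avgNorm_nonneg _ _ _) _)) _
  have hS0 : 0 ≤ S := Real.iSup_nonneg fun _ => abs_nonneg _
  -- The slack `η` keeps the level `k` positive even when the right side vanishes.
  refine le_of_forall_pos_le_add fun η hη => ?_
  set k := δ * (n : ℝ) ^ (-(m - 2)) * S + C * X ^ κ * W + η with hk
  have hk0 : 0 < k := by positivity
  have hSk : S * (n : ℝ) ^ 2 * δ ≤ k * (n : ℝ) ^ m := by
    have e : (n : ℝ) ^ (-(m - 2)) * (n : ℝ) ^ m = (n : ℝ) ^ 2 := by
      rw [← Real.rpow_add hn0, ← Real.rpow_two]; congr 1; ring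
    calc S * (n : ℝ) ^ 2 * δ = δ * (n : ℝ) ^ (-(m - 2)) * S * (n : ℝ) ^ m := by rw [← e]; ring
      _ ≤ _ := by
        refine mul_le_mul_of_nonneg_right ?_ (by positivity)
        have : 0 ≤ C * X ^ κ * W := by positivity
        linarith
  -- The second summand of `k` gives `k ≥ C X^κ W`, which is the required smallness of the initial
  -- mass; it is stated for general `v` to serve both `u` and `-u`.
  have hinit : ∀ {v : ℝ → ZGrid d → ℝ}, levelMass p A n v θ 0 ≤ W ^ 2 →
      (levelMass p A n v θ 0 / k ^ 2) ^ ε * (C₃ * X) ^ (1 + ε) ≤ β ^ (-((1 + ε) / ε)) := by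
    intro v hv
    have hv0 : 0 ≤ levelMass p A n v θ 0 := CaloricData.levelMass_nonneg A (by linarith) 0
    have hB : 0 < C * X ^ κ := by positivity
    have h1 : levelMass p A n v θ 0 / k ^ 2 ≤ ((C * X ^ κ) ^ 2)⁻¹ := by
      rw [div_le_iff₀ (by positivity), ← div_eq_inv_mul, le_div_iff₀ (by positivity), mul_comm]
      refine le_trans (mul_le_mul_of_nonneg_left hv (by positivity)) ?_
      rw [← mul_pow]
      refine pow_le_pow_left₀ (by positivity) ?_ 2
      have : 0 ≤ δ * (n : ℝ) ^ (-(m - 2)) * S := by positivity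
      linarith
    have h2 : ((C * X ^ κ) ^ 2) ^ ε = (C₃ * X) ^ (1 + ε) * β ^ ((1 + ε) / ε) := by
      rw [← Real.rpow_two, ← Real.rpow_mul hB.le, Real.mul_rpow hC0.le (by positivity),
        ← Real.rpow_mul hX0.le, hC, ← Real.rpow_mul (by positivity), hκ]
      have e1 : 1 / (2 * ε) * (2 * ε) = 1 := by field_simp
      have e2 : (1 + ε) / (2 * ε) * (2 * ε) = 1 + ε := by field_simp
      rw [e1, e2, Real.rpow_one, Real.mul_rpow hC₃0.le hX0.le]
      ring
    calc (levelMass p A n v θ 0 / k ^ 2) ^ ε * (C₃ * X) ^ (1 + ε)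
        ≤ (((C * X ^ κ) ^ 2)⁻¹) ^ ε * (C₃ * X) ^ (1 + ε) := by
          gcongr
      _ = β ^ (-((1 + ε) / ε)) := by
          rw [Real.inv_rpow (by positivity), h2, Real.rpow_neg hβ0.le]
          field_simp
  have hθ'0 : 0 < θ' := by linarith
  have hνmax : ∀ x, 1 ≤ max (E.nu ω x) 1 := fun x => le_max_right _ _
  have hlev := hdata.levelMass_le_parNorm_sq hp hn0 (by linarith) hθ1
  have hlevn := hdata.neg.levelMass_le_parNorm_sq hp hn0 (by linarith) hθ1
  have hparneg : parNorm (2 * p.conjExponent) 2 (Icc (-(θ * (n : ℝ) ^ 2)) 0) A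
      (fun t x => -u t x) = W := by
    rw [hW]
    simp only [parNorm, avgNorm, abs_neg]
  rw [hparneg] at hlevn
  rw [abs_le']
  exact ⟨hdata.le_of_levelMass_le hd hp hq hAne hνmax hn0 hm hcard hθ'0 hθ hθ1 subset_rfl hk0 hδ hδ2
      hSk hε hε0 hX0 hXle (hinit hlev) ht hx,
    hdata.neg.le_of_levelMass_le hd hp hq hAne hνmax hn0 hm hcard hθ'0 hθ hθ1 subset_rfl hk0 hδ hδ2
      hSk hε hε0 hX0 hXle (hinit hlevn) ht hx⟩
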